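/- For real $n>0$, an integer $N\ge1$ and a rate vector $Q\in\mathbb R_+^N$, let $H(Q)$ be the hypothesis that $O_1,\dots,O_N$ are independent with $O_i\sim\mathrm{Pois}(nQ_i)$, and put $U=(1/N,\dots,1/N)$, $H_0=H(U)$. For a test $\psi:\{0,1,2,\dots\}^N\to\{0,1\}$ let $R(\psi;Q)=\Pr[\psi=1\mid H_0]+\Pr[\psi=0\mid H(Q)]$, and for a set $V$ of rate vectors let $R^*(V)=\inf_\psi\sup_{Q\in V}R(\psi;Q)$. Fix $p\in(0,2]$ and, for $\epsilon>0$ and $\xi$ real, let $$V_\epsilon=\Big\{Q\in\mathbb R_+^N:\ \sum_{i=1}^N|Q_i-1/N|^p\ge\epsilon^p\Big\},\qquad V_{\epsilon,\xi}=V_\epsilon\cap\Big\{Q\in\mathbb R_+^N:\ \max_{1\le i\le N}|Q_i-1/N|\le\xi/N\Big\},$$ $$u^*=u^*_{\epsilon,n,N}=\frac{\epsilon^2\,n}{\sqrt{2N}}\,N^{2-2/p},$$ and let $\Phi$ be the standard normal cumulative distribution function. Theorem 3. Let $n=n_k$, $N=N_k$, $\epsilon=\epsilon_k>0$, $\xi=\xi_k$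 be sequences such that, as $k\to\infty$, $n\to\infty$, $N\to\infty$, $\epsilon\to0$, $\xi\to0$, while $n/N\le M$ for a fixed $M\in\mathbb R$ and $\epsilon\le\xi N^{-1+1/p}$ (equivalently, $V_{\epsilon,\xi}\neq\emptyset$) for all $k$. (a) If $u^*_{\epsilon,n,N}\to c$ for some $c\ge0$, then $$\frac{R^*(V_{\epsilon,\xi})}{2\Phi(-u^*_{\epsilon,n,N}/2)}\to1 .$$ (b) $R^*(V_\epsilon)\ge 2\Phi(-u^*_{\epsilon,n,N}/2)+o(1)$. (c) If $R^*(V_{\epsilon,\xi})\to0$, or if $R^*(V_\epsilon)\to0$, then $\dfrac{\epsilon^2\,n}{\sqrt N}\,N^{2-2/p}\to\infty$. -/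

import Mathlib

open Filter Topology MeasureTheory ProbabilityTheory

namespace PoissonUniformity

/-- The law of the data `(O_1, …, O_N)` under `H(Q)`: independent coordinates with
`O_i ∼ Pois(n Q_i)`. It is only used for `n ≥ 0` and `Q_i ≥ 0`. -/
noncomputable def dataLaw (n : ℝ) {N : ℕ} (Q : Fin N → ℝ) : Measure (Fin N → ℕ) :=
  Measure.pi fun i => poissonMeasure (n * Q i).toNNReal

/-- The uniform rate vector `U = (1/N, …, 1/N)`. -/
noncomputable def uniformRate (N : ℕ) : Fin N → ℝ := fun _ => 1 / (N : ℝ)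

/-- A (non-randomized) test; the value `true` means that the null hypothesis is rejected. -/
abbrev Test (N : ℕ) : Type := (Fin N → ℕ) → Bool

/-- The risk `R(ψ; Q)`: probability of type I error plus probability of type II error. -/
noncomputable def risk (n : ℝ) {N : ℕ} (ψ : Test N) (Q : Fin N → ℝ) : ℝ :=
  (dataLaw n (uniformRate N)).real {o | ψ o = true} + (dataLaw n Q).real {o | ψ o = false}

/-- The minimax risk `R*(V) = inf_ψ sup_{Q ∈ V} R(ψ; Q)` over a (non-empty) set `V` of
alternatives. All risks lie in `[0, 2]`, so the supremum and the infimum are genuine. -/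
noncomputable def minimaxRisk (n : ℝ) {N : ℕ} (V : Set (Fin N → ℝ)) : ℝ :=
  ⨅ ψ : Test N, ⨆ Q : V, risk n ψ (Q : Fin N → ℝ)

/-- `V_ε`: nonnegative rate vectors outside the open `ℓ_p` ball of radius `ε` around `U`. -/
def altSet (N : ℕ) (p ε : ℝ) : Set (Fin N → ℝ) :=
  {Q | (∀ i, 0 ≤ Q i) ∧ ε ^ p ≤ ∑ i, |Q i - 1 / (N : ℝ)| ^ p}

/-- `V_{ε,ξ}`: the members of `V_ε` in the hypercube of radius `ξ / N` around `U`. -/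
def altSetCube (N : ℕ) (p ε ξ : ℝ) : Set (Fin N → ℝ) :=
  altSet N p ε ∩ {Q | (∀ i, 0 ≤ Q i) ∧ ∀ i, |Q i - 1 / (N : ℝ)| ≤ ξ / (N : ℝ)}

/-- `u*_{ε,n,N} = ε² n N^{2 - 2/p} / √(2N)`. -/
noncomputable def uStar (p ε n : ℝ) (N : ℕ) : ℝ :=
  ε ^ 2 * n / Real.sqrt (2 * (N : ℝ)) * (N : ℝ) ^ (2 - 2 / p)

/-- The standard normal cumulative distribution function `Φ`. -/
noncomputable def stdNormalCDF (x : ℝ) : ℝ := cdf (gaussianReal 0 1) x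

end PoissonUniformity

/-!
Why the theorem holds. Write `δ = ε N^{1 - 1/p} ≤ ξ` and `λ = n / N`, so that `u* = δ² n / √(2N)`.

*Lower bound.* The rate vectors `((1 ± δ) / N)`, one for each vector of signs, lie on the boundary of
the `ℓ_p` ball and in the hypercube. For the uniform prior on them the Bayes risk is
`E₀ min (1, ∏ᵢ Lᵢ)`, where the likelihood ratios `Lᵢ` of the single counts are independent under the
null hypothesis. The centred variables `Lᵢ - 1` have total variance `N (cosh (λ δ²) - 1) ≈ (u*)²` and
total fourth moment of order `(u*)² δ⁴ → 0`. Hence their sum is asymptotically `N(0, c²)` as `u* → c`,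
the logarithm of the product is asymptotically `N(-c²/2, c²)` by a second-order expansion
(`IsLyapunovArray.tendsto_integral_min_one_prod`), and the Bayes risk tends to the affinity of
`N(0, 1)` and `N(c, 1)`, which is `2 Φ(-c/2)`. This is `IsRegime.exists_lower_bound`.

*Upper bound.* The statistic `∑ᵢ ((Oᵢ - λ)² - Oᵢ) / (λ √(2N))` has mean zero and variance one under
the null hypothesis. Under an alternative its mean is at least `u*`, by the power mean inequality with
`p ≤ 2`, and its variance tends to one uniformly over the hypercube. If `u* → c > 0`, then
`n² / N → ∞` and its Lyapunov condition holds, so the test with threshold `u* / 2` has both error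
probabilities at most `Φ(-c/2) + o(1)`. If `c = 0`, the bound `1` of the trivial test is sharp. This
is `IsRegime.exists_upper_bound`.

Both sides rest on a Lyapunov central limit theorem for triangular arrays,
`IsLyapunovArray.tendsto_gaussianReal`. Both arrays have fourth moments controlled by one envelope,
`envelope_fourth_moment`, which captures that, for small `λ`, a count contributes at leading order
only when it is at least two. The remaining assertions follow by passing to subsequences along which
`u*` converges in `[0, ∞]`, where in the case `∞` there is nothing to prove
(`IsRegime.exists_remainder`).
-/

namespace PoissonUniformity

/-! ### A Lyapunov central limit theorem for triangular arrays -/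

/-- A second-order Taylor bound for the characteristic exponential, valid for all real `x`. -/
lemma norm_cexp_mul_I_sub_taylor_le (x : ℝ) :
    ‖Complex.exp (x * Complex.I) - (1 + x * Complex.I - x ^ 2 / 2)‖ ≤ 4 * |x| ^ 3 := by
  have hxn : ‖(x : ℂ) * Complex.I‖ = |x| := by simp
  rcases le_or_gt |x| 1 with h | h
  · have := Complex.exp_bound (x := x * Complex.I) (by rw [hxn]; exact h) (n := 3) (by norm_num)
    rw [hxn] at this
    have h2 : ∑ m ∈ Finset.range 3, ((x : ℂ) * Complex.I) ^ m / (m.factorial : ℂ)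
        = 1 + x * Complex.I - x ^ 2 / 2 := by
      simp [Finset.sum_range_succ, mul_pow]
      ring
    rw [h2] at this
    refine this.trans ?_
    have : (0 : ℝ) ≤ |x| ^ 3 := by positivity
    norm_num [Nat.factorial]
    linarith
  · have h1 : ‖Complex.exp (x * Complex.I)‖ = 1 := Complex.norm_exp_ofReal_mul_I x
    have h2 : ‖(1 + x * Complex.I - x ^ 2 / 2 : ℂ)‖ ≤ 1 + |x| + |x| ^ 2 / 2 := by
      refine (norm_sub_le _ _).trans ?_
      refine add_le_add ((norm_add_le _ _).trans ?_) ?_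
      · rw [hxn]; simp
      · simp
    refine (norm_sub_le _ _).trans ?_
    rw [h1]
    nlinarith [mul_pos (sub_pos.2 h) (sub_pos.2 h), sq_nonneg (|x|), abs_nonneg x,
      mul_nonneg (abs_nonneg x) (mul_nonneg (sub_nonneg.2 h.le) (sub_nonneg.2 h.le)),
      mul_pos (sub_pos.2 h) (abs_pos.2 (abs_pos.1 (by linarith : (0:ℝ) < |x|)))]

lemma norm_prod_sub_prod_le_sum {ι : Type*} (s : Finset ι) (a b : ι → ℂ)
    (ha : ∀ i ∈ s, ‖a i‖ ≤ 1) (hb : ∀ i ∈ s, ‖b i‖ ≤ 1) :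
    ‖∏ i ∈ s, a i - ∏ i ∈ s, b i‖ ≤ ∑ i ∈ s, ‖a i - b i‖ := by
  classical
  induction s using Finset.induction_on with
  | empty => simp
  | insert j s hj ih =>
    rw [Finset.prod_insert hj, Finset.prod_insert hj, Finset.sum_insert hj]
    have hP : ‖∏ i ∈ s, a i‖ ≤ 1 := by
      rw [norm_prod]
      exact Finset.prod_le_one (fun _ _ => norm_nonneg _)
        fun i hi => ha i (Finset.mem_insert_of_mem hi)
    have ih' := ih (fun i hi => ha i (Finset.mem_insert_of_mem hi))
      (fun i hi => hb i (Finset.mem_insert_of_mem hi))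
    have hbj := hb j (Finset.mem_insert_self _ _)
    calc ‖a j * ∏ i ∈ s, a i - b j * ∏ i ∈ s, b i‖
        = ‖(a j - b j) * ∏ i ∈ s, a i + b j * (∏ i ∈ s, a i - ∏ i ∈ s, b i)‖ := by ring_nf
      _ ≤ ‖a j - b j‖ * ‖∏ i ∈ s, a i‖ + ‖b j‖ * ‖∏ i ∈ s, a i - ∏ i ∈ s, b i‖ := by
          refine (norm_add_le _ _).trans ?_
          rw [norm_mul, norm_mul]
      _ ≤ ‖a j - b j‖ + ∑ i ∈ s, ‖a i - b i‖ := by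
          refine add_le_add (mul_le_of_le_one_right (norm_nonneg _) hP) ?_
          exact (mul_le_of_le_one_left (norm_nonneg _) hbj).trans ih'

/-- Lower powers are controlled by the second and fourth ones with an adjustable weight. -/
lemma abs_pow_three_le (x : ℝ) {η : ℝ} (hη : 0 < η) : |x| ^ 3 ≤ η * x ^ 2 + x ^ 4 / η := by
  have h1 : x ^ 4 / η * η = x ^ 4 := div_mul_cancel₀ _ hη.ne'
  have h2 : x ^ 2 = |x| ^ 2 := (sq_abs x).symm
  have h3 : x ^ 4 = |x| ^ 4 := by rw [show x ^ 4 = (x ^ 2) ^ 2 by ring, h2]; ring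
  rw [h3, h2, ← sub_nonneg]
  have : η * |x| ^ 2 + |x| ^ 4 / η - |x| ^ 3
      = |x| ^ 2 * ((η - |x|) ^ 2 + η * |x|) / η := by
    field_simp; ring
  rw [this]; positivity

section FourthMoment

variable {X : Type*} [MeasurableSpace X] {ν : Measure X} {g : X → ℝ}

lemma memLp_four_of_integrable_pow (hg : Measurable g) (h : Integrable (fun x => g x ^ 4) ν) :
    MemLp g 4 ν := by
  rw [← integrable_norm_rpow_iff hg.aestronglyMeasurable (by norm_num) (by norm_num)]
  refine h.congr (ae_of_all _ fun x => ?_)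
  simp only [ENNReal.toReal_ofNat]
  rw [show (4 : ℝ) = ((4 : ℕ) : ℝ) by norm_num, Real.rpow_natCast, Real.norm_eq_abs,
    ← abs_pow, abs_of_nonneg (by positivity)]

variable [IsProbabilityMeasure ν]

lemma memLp_two_of_integrable_pow (hg : Measurable g) (h : Integrable (fun x => g x ^ 4) ν) :
    MemLp g 2 ν :=
  (memLp_four_of_integrable_pow hg h).mono_exponent (by norm_num)

lemma integrable_sq_of_integrable_pow (hg : Measurable g)
    (h : Integrable (fun x => g x ^ 4) ν) : Integrable (fun x => g x ^ 2) ν :=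
  (memLp_two_of_integrable_pow hg h).integrable_sq

lemma integrable_of_integrable_pow (hg : Measurable g)
    (h : Integrable (fun x => g x ^ 4) ν) : Integrable g ν :=
  (memLp_two_of_integrable_pow hg h).integrable (by norm_num)

lemma sq_integral_sq_le (hg : Measurable g) (h : Integrable (fun x => g x ^ 4) ν) :
    (∫ x, g x ^ 2 ∂ν) ^ 2 ≤ ∫ x, g x ^ 4 ∂ν := by
  have h2 := integrable_sq_of_integrable_pow hg h
  set m := ∫ x, g x ^ 2 ∂ν
  have : 0 ≤ ∫ x, (g x ^ 2 - m) ^ 2 ∂ν := integral_nonneg fun x => sq_nonneg _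
  have e : ∫ x, (g x ^ 2 - m) ^ 2 ∂ν = (∫ x, g x ^ 4 ∂ν) - 2 * m * m + m ^ 2 := by
    have : ∀ x, (g x ^ 2 - m) ^ 2 = g x ^ 4 - 2 * m * g x ^ 2 + m ^ 2 := fun x => by ring
    simp_rw [this]
    have hs : Integrable (fun x => g x ^ 4 - 2 * m * g x ^ 2) ν := h.sub (h2.const_mul _)
    rw [integral_add hs (integrable_const _), integral_sub h (h2.const_mul _), integral_const_mul]
    simp [m]
  nlinarith

/-- The characteristic function of a centred variable with finite fourth moment is close to that
of the centred normal law of the same variance. -/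
lemma norm_integral_cexp_sub_le (hg : Measurable g) (h : Integrable (fun x => g x ^ 4) ν)
    (hm : ∫ x, g x ∂ν = 0) (t : ℝ) {η : ℝ} (hη : 0 < η) :
    ‖∫ x, Complex.exp ((t * g x : ℝ) * Complex.I) ∂ν
        - Complex.exp ((-(t ^ 2 * (∫ x, g x ^ 2 ∂ν) / 2) : ℝ))‖
      ≤ 4 * |t| ^ 3 * (η * (∫ x, g x ^ 2 ∂ν) + (∫ x, g x ^ 4 ∂ν) / η)
        + t ^ 4 * ∫ x, g x ^ 4 ∂ν := by
  have h1 := integrable_of_integrable_pow hg h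
  have h2 := integrable_sq_of_integrable_pow hg h
  set v := ∫ x, g x ^ 2 ∂ν
  set q := ∫ x, g x ^ 4 ∂ν
  have hvq : v ^ 2 ≤ q := sq_integral_sq_le hg h
  have hv : 0 ≤ v := integral_nonneg fun x => sq_nonneg _
  have hT : ∫ x, (1 + (t * g x : ℝ) * Complex.I - ((t * g x : ℝ) : ℂ) ^ 2 / 2) ∂ν
      = ((1 - t ^ 2 * v / 2 : ℝ) : ℂ) := by
    have e : ∀ x, (1 + (t * g x : ℝ) * Complex.I - ((t * g x : ℝ) : ℂ) ^ 2 / 2)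
        = ((1 - t ^ 2 / 2 * g x ^ 2 : ℝ) : ℂ) + ((g x : ℝ) : ℂ) * (t * Complex.I) := by
      intro x; push_cast; ring
    simp_rw [e]
    have hs : Integrable (fun x => ((1 - t ^ 2 / 2 * g x ^ 2 : ℝ) : ℂ)) ν :=
      ((integrable_const _).sub (h2.const_mul _)).ofReal
    have hs' : Integrable (fun x => ((g x : ℝ) : ℂ) * (t * Complex.I)) ν :=
      h1.ofReal.mul_const _
    rw [integral_add hs hs',
      integral_mul_const, integral_complex_ofReal, integral_complex_ofReal, hm,
      integral_sub (integrable_const _) (h2.const_mul _), integral_const_mul]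
    simp [v]; ring
  have hexpint : Integrable (fun x => Complex.exp ((t * g x : ℝ) * Complex.I)) ν := by
    refine Integrable.of_bound (C := 1) (by fun_prop) (ae_of_all _ fun x => ?_)
    rw [Complex.norm_exp_ofReal_mul_I]
  have hTint : Integrable
      (fun x => (1 + (t * g x : ℝ) * Complex.I - ((t * g x : ℝ) : ℂ) ^ 2 / 2)) ν := by
    refine ((integrable_const _).add ((h1.const_mul t).ofReal.mul_const _)).sub ?_
    refine Integrable.div_const ?_ _
    have : Integrable (fun x => ((t ^ 2 * g x ^ 2 : ℝ) : ℂ)) ν := (h2.const_mul (t ^ 2)).ofReal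
    refine this.congr (ae_of_all _ fun x => ?_)
    push_cast; ring
  have hA : ‖∫ x, Complex.exp ((t * g x : ℝ) * Complex.I) ∂ν - ((1 - t ^ 2 * v / 2 : ℝ) : ℂ)‖
      ≤ 4 * |t| ^ 3 * (η * v + q / η) := by
    rw [← hT, ← integral_sub hexpint hTint]
    have hbi : Integrable (fun x => 4 * |t| ^ 3 * (η * g x ^ 2 + g x ^ 4 / η)) ν :=
      ((h2.const_mul _).add (h.div_const _)).const_mul _
    refine (norm_integral_le_of_norm_le hbi (ae_of_all _ fun x => ?_)).trans ?_
    · refine (norm_cexp_mul_I_sub_taylor_le (t * g x)).trans ?_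
      rw [abs_mul, mul_pow, ← mul_assoc]
      exact mul_le_mul_of_nonneg_left (abs_pow_three_le _ hη) (by positivity)
    · rw [integral_const_mul, integral_add (h2.const_mul _) (h.div_const _), integral_const_mul,
        integral_div]
  have hB : ‖((1 - t ^ 2 * v / 2 : ℝ) : ℂ) - Complex.exp ((-(t ^ 2 * v / 2) : ℝ))‖
      ≤ t ^ 4 * q := by
    rw [← Complex.ofReal_exp, ← Complex.ofReal_sub, Complex.norm_real, Real.norm_eq_abs]
    set y := t ^ 2 * v / 2 with hy
    have hy0 : 0 ≤ y := by positivity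
    have hy2 : y ^ 2 ≤ t ^ 4 * q := by
      have : y ^ 2 = t ^ 4 * v ^ 2 / 4 := by rw [hy]; ring
      rw [this]
      nlinarith [mul_le_mul_of_nonneg_left hvq (by positivity : 0 ≤ t ^ 4),
        (by positivity : 0 ≤ t ^ 4 * v ^ 2)]
    refine le_trans ?_ hy2
    have hl : 1 - y ≤ Real.exp (-y) := by linarith [Real.add_one_le_exp (-y)]
    rw [abs_sub_comm, abs_of_nonneg (by linarith)]
    rcases le_or_gt y 1 with h1 | h1
    · have := Real.abs_exp_sub_one_sub_id_le (x := -y) (by rw [abs_neg, abs_of_nonneg hy0]; exact h1)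
      have := (abs_le.1 this).2
      nlinarith
    · have : Real.exp (-y) ≤ 1 := Real.exp_le_one_iff.2 (by linarith)
      nlinarith
  calc _ ≤ _ := norm_sub_le_norm_sub_add_norm_sub _ ((1 - t ^ 2 * v / 2 : ℝ) : ℂ) _
    _ ≤ _ := add_le_add hA hB

end FourthMoment

/-- A row-wise independent triangular array, given by laws `ν k i` and functions `g k i`, that is
eventually centred with finite fourth moments, whose total variance converges to `s` and whose
total fourth moment vanishes in the limit. -/
structure IsLyapunovArray {X : Type*} [MeasurableSpace X] {N : ℕ → ℕ}
    (ν : ∀ k, Fin (N k) → Measure X) (g : ∀ k, Fin (N k) → X → ℝ) (s : ℝ) : Prop where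
  measurable : ∀ k i, Measurable (g k i)
  integrable : ∀ᶠ k in atTop, ∀ i, Integrable (fun x => g k i x ^ 4) (ν k i)
  mean : ∀ᶠ k in atTop, ∀ i, ∫ x, g k i x ∂ν k i = 0
  variance : Tendsto (fun k => ∑ i, ∫ x, g k i x ^ 2 ∂ν k i) atTop (𝓝 s)
  fourth : Tendsto (fun k => ∑ i, ∫ x, g k i x ^ 4 ∂ν k i) atTop (𝓝 0)

section Lyapunov

variable {X : Type*} [MeasurableSpace X] {N : ℕ → ℕ} {ν : ∀ k, Fin (N k) → Measure X}
  {g : ∀ k, Fin (N k) → X → ℝ} {s : ℝ}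

lemma IsLyapunovArray.limit_nonneg (h : IsLyapunovArray ν g s) : 0 ≤ s :=
  ge_of_tendsto h.variance (Eventually.of_forall fun _ =>
    Finset.sum_nonneg fun _ _ => integral_nonneg fun _ => sq_nonneg _)

/-- A sequence that, for every `η > 0`, is eventually dominated by some sequence with limit at most
`η * C` tends to zero. -/
lemma tendsto_zero_of_forall_eta {f : ℕ → ℝ} (C : ℝ) (F : ℝ → ℕ → ℝ)
    (hf : ∀ k, 0 ≤ f k) (hF : ∀ η, 0 < η → ∀ᶠ k in atTop, f k ≤ F η k)
    (hlim : ∀ η, 0 < η → Tendsto (F η) atTop (𝓝 (η * C))) : Tendsto f atTop (𝓝 0) := by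
  rw [Metric.tendsto_nhds]
  intro e he
  have hη : 0 < e / (2 * (|C| + 1)) := by positivity
  have hlt : e / (2 * (|C| + 1)) * C < e := by
    have h1 : e / (2 * (|C| + 1)) * C ≤ e / (2 * (|C| + 1)) * |C| :=
      mul_le_mul_of_nonneg_left (le_abs_self C) hη.le
    have h2 : e / (2 * (|C| + 1)) * (|C| + 1) = e / 2 := by field_simp
    nlinarith
  filter_upwards [hF _ hη, (hlim _ hη).eventually_lt_const hlt] with k h1 h2
  rw [Real.dist_eq, sub_zero, abs_of_nonneg (hf k)]
  linarith

variable [∀ k i, IsProbabilityMeasure (ν k i)]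

/-- The characteristic functions of the row sums converge to that of `N(0, s)`: the factors are
replaced one at a time by Gaussian ones, at a total cost that vanishes by the moment conditions. -/
lemma IsLyapunovArray.tendsto_prod_charFun (h : IsLyapunovArray ν g s) (t : ℝ) :
    Tendsto (fun k => ∏ i, ∫ x, Complex.exp ((t * g k i x : ℝ) * Complex.I) ∂ν k i) atTop
      (𝓝 (Complex.exp ((-(t ^ 2 * s / 2) : ℝ)))) := by
  have hmain : Tendsto (fun k => Complex.exp
      ((-(t ^ 2 * (∑ i, ∫ x, g k i x ^ 2 ∂ν k i) / 2) : ℝ))) atTop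
      (𝓝 (Complex.exp ((-(t ^ 2 * s / 2) : ℝ)))) := by
    have hc : Continuous fun s : ℝ => Complex.exp ((-(t ^ 2 * s / 2) : ℝ)) := by fun_prop
    exact (hc.tendsto s).comp h.variance
  refine (tendsto_iff_of_dist ?_).2 hmain
  simp only [dist_eq_norm]
  refine tendsto_zero_of_forall_eta (4 * |t| ^ 3 * s)
    (fun η k => 4 * |t| ^ 3 * (η * (∑ i, ∫ x, g k i x ^ 2 ∂ν k i)
      + (∑ i, ∫ x, g k i x ^ 4 ∂ν k i) / η) + t ^ 4 * ∑ i, ∫ x, g k i x ^ 4 ∂ν k i)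
    (fun _ => norm_nonneg _) (fun η hη => ?_) (fun η hη => ?_)
  · filter_upwards [h.integrable, h.mean] with k hint hmean
    have e : Complex.exp ((-(t ^ 2 * (∑ i, ∫ x, g k i x ^ 2 ∂ν k i) / 2) : ℝ))
        = ∏ i, Complex.exp ((-(t ^ 2 * (∫ x, g k i x ^ 2 ∂ν k i) / 2) : ℝ)) := by
      rw [← Complex.exp_sum]
      congr 1
      push_cast
      rw [Finset.mul_sum, Finset.sum_div, Finset.sum_neg_distrib]
    rw [e]
    refine (norm_prod_sub_prod_le_sum _ _ _ (fun i _ => ?_) (fun i _ => ?_)).trans ?_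
    · refine (norm_integral_le_of_norm_le_const (C := 1) (ae_of_all _ fun x => ?_)).trans ?_
      · rw [Complex.norm_exp_ofReal_mul_I]
      · simp
    · rw [← Complex.ofReal_exp, Complex.norm_real, Real.norm_eq_abs, Real.abs_exp,
        Real.exp_le_one_iff]
      have : 0 ≤ ∫ x, g k i x ^ 2 ∂ν k i := integral_nonneg fun x => sq_nonneg _
      have : 0 ≤ t ^ 2 * (∫ x, g k i x ^ 2 ∂ν k i) := by positivity
      linarith
    · refine (Finset.sum_le_sum fun i _ =>
        norm_integral_cexp_sub_le (h.measurable k i) (hint i) (hmean i) t hη).trans ?_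
      rw [Finset.sum_add_distrib, ← Finset.mul_sum, ← Finset.mul_sum, Finset.sum_add_distrib,
        ← Finset.mul_sum, Finset.sum_div]
  · have := (((h.variance.const_mul η).add (h.fourth.div_const η)).const_mul (4 * |t| ^ 3)).add
      (h.fourth.const_mul (t ^ 4))
    convert this using 2
    simp; ring

/-- The **Lyapunov central limit theorem** for a triangular array with converging shifts. -/
theorem IsLyapunovArray.tendsto_gaussianReal (h : IsLyapunovArray ν g s) {b : ℕ → ℝ} {β : ℝ}
    (hb : Tendsto b atTop (𝓝 β)) {P : ℕ → ProbabilityMeasure ℝ}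
    (hP : ∀ k, (P k : Measure ℝ)
      = (Measure.pi (ν k)).map (fun o => b k + ∑ i, g k i (o i)))
    {G : ProbabilityMeasure ℝ} (hG : (G : Measure ℝ) = gaussianReal β s.toNNReal) :
    Tendsto P atTop (𝓝 G) := by
  refine ProbabilityMeasure.tendsto_of_tendsto_charFun fun t => ?_
  have hmeas : ∀ k, Measurable (fun o : Fin (N k) → X => b k + ∑ i, g k i (o i)) := fun k =>
    measurable_const.add (Finset.measurable_sum _ fun i _ =>
      (h.measurable k i).comp (measurable_pi_apply i))
  rw [hG, charFun_gaussianReal]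
  have hc : ∀ k, charFun (P k : Measure ℝ) t = Complex.exp ((t * b k : ℝ) * Complex.I) *
      ∏ i, ∫ x, Complex.exp ((t * g k i x : ℝ) * Complex.I) ∂ν k i := by
    intro k
    rw [hP, charFun_apply_real, integral_map (hmeas k).aemeasurable (by fun_prop),
      ← integral_fintype_prod_eq_prod, ← integral_const_mul]
    refine integral_congr_ae (ae_of_all _ fun o => ?_)
    simp only
    rw [← Complex.exp_sum, ← Complex.exp_add]
    congr 1
    push_cast
    rw [← Finset.sum_mul, ← Finset.mul_sum]
    ring
  simp_rw [hc]
  have h1 : Tendsto (fun k => Complex.exp ((t * b k : ℝ) * Complex.I)) atTop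
      (𝓝 (Complex.exp ((t * β : ℝ) * Complex.I))) := by
    have : Continuous fun y : ℝ => Complex.exp ((t * y : ℝ) * Complex.I) := by fun_prop
    exact (this.tendsto β).comp hb
  convert h1.mul (h.tendsto_prod_charFun t) using 2
  rw [← Complex.exp_add]
  congr 1
  have : ((s.toNNReal : ℝ) : ℂ) = (s : ℂ) := by rw [Real.coe_toNNReal _ h.limit_nonneg]
  rw [this]
  push_cast
  ring

end Lyapunov

/-! ### Gaussian limits of tail probabilities and of testing affinities -/

lemma stdNormalCDF_eq (x : ℝ) : stdNormalCDF x = (gaussianReal 0 1).real (Set.Iic x) := by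
  rw [stdNormalCDF, cdf_eq_real]

lemma gaussianReal_real_Iic (β x : ℝ) :
    (gaussianReal β 1).real (Set.Iic x) = stdNormalCDF (x - β) := by
  have h := gaussianReal_map_add_const (μ := 0) (v := 1) β
  rw [zero_add] at h
  rw [stdNormalCDF_eq, ← h, map_measureReal_apply (by fun_prop) measurableSet_Iic]
  congr 1
  ext y
  simp [le_sub_iff_add_le]

lemma gaussianReal_real_Ioi (x : ℝ) :
    (gaussianReal 0 1).real (Set.Ioi x) = stdNormalCDF (-x) := by
  have h := gaussianReal_map_neg (μ := 0) (v := 1)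
  have : NullSingletonClass (gaussianReal 0 1) := nullSingletonClass_gaussianReal one_ne_zero
  rw [neg_zero] at h
  rw [stdNormalCDF_eq, measureReal_congr (Ioi_ae_eq_Ici (a := x))]
  conv_lhs => rw [← h]
  rw [map_measureReal_apply (by fun_prop) measurableSet_Ici]
  congr 1
  ext y
  simp

lemma one_sub_stdNormalCDF (x : ℝ) : 1 - stdNormalCDF x = stdNormalCDF (-x) := by
  rw [← gaussianReal_real_Ioi, stdNormalCDF_eq, ← Set.compl_Iic,
    probReal_compl_eq_one_sub measurableSet_Iic]

lemma stdNormalCDF_zero : stdNormalCDF 0 = 1 / 2 := by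
  have := one_sub_stdNormalCDF 0
  rw [neg_zero] at this
  linarith

lemma stdNormalCDF_mono : Monotone stdNormalCDF := monotone_cdf _

lemma stdNormalCDF_nonneg (x : ℝ) : 0 ≤ stdNormalCDF x := cdf_nonneg _ _

lemma stdNormalCDF_pos (x : ℝ) : 0 < stdNormalCDF x := by
  rw [stdNormalCDF_eq, measureReal_def, ENNReal.toReal_pos_iff]
  refine ⟨?_, measure_lt_top _ _⟩
  rw [pos_iff_ne_zero]
  intro h
  have := gaussianReal_absolutelyContinuous' 0 (v := 1) one_ne_zero h
  simp at this

lemma continuous_stdNormalCDF : Continuous stdNormalCDF := by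
  have : NullSingletonClass (gaussianReal 0 1) := nullSingletonClass_gaussianReal one_ne_zero
  rw [continuous_iff_continuousAt]
  intro x
  have h := (cdf (gaussianReal 0 1)).measure_singleton x
  rw [measure_cdf, measure_singleton, eq_comm, ENNReal.ofReal_eq_zero, sub_nonpos] at h
  have hmono := monotone_cdf (gaussianReal 0 1)
  refine continuousAt_iff_continuous_left'_right'.2 ⟨?_, ?_⟩
  · exact hmono.continuousWithinAt_Iio_iff_leftLim_eq.2 (le_antisymm (hmono.leftLim_le le_rfl) h)
  · exact ((cdf (gaussianReal 0 1)).right_continuous x).mono Set.Ioi_subset_Ici_self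

lemma tendsto_stdNormalCDF_atBot : Tendsto stdNormalCDF atBot (𝓝 0) := tendsto_cdf_atBot _

/-- The affinity between `N(0, 1)` and `N(c, 1)`. -/
lemma integral_min_one_exp_stdNormal {c : ℝ} (hc : 0 ≤ c) :
    ∫ w, min 1 (Real.exp (c * w + -(c ^ 2 / 2))) ∂gaussianReal 0 1
      = 2 * stdNormalCDF (-c / 2) := by
  have hdens : ∀ w, gaussianPDFReal 0 1 w * min 1 (Real.exp (c * w + -(c ^ 2 / 2)))
      = (Set.Iic (c / 2)).indicator (gaussianPDFReal c 1) w
        + (Set.Ioi (c / 2)).indicator (gaussianPDFReal 0 1) w := by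
    intro w
    -- at `w = c / 2` the two normal densities cross
    by_cases hw : w ≤ c / 2
    · have h1 : w ∈ Set.Iic (c / 2) := hw
      have h2 : w ∉ Set.Ioi (c / 2) := by simpa using hw
      rw [Set.indicator_of_mem h1, Set.indicator_of_notMem h2, min_eq_right, add_zero]
      · rw [gaussianPDFReal_def, gaussianPDFReal_def]
        simp only [NNReal.coe_one]
        rw [mul_assoc, ← Real.exp_add]
        congr 2
        ring
      · rw [Real.exp_le_one_iff]; nlinarith
    · have h1 : w ∉ Set.Iic (c / 2) := hw
      have h2 : w ∈ Set.Ioi (c / 2) := by simpa using hw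
      rw [Set.indicator_of_notMem h1, Set.indicator_of_mem h2, min_eq_left, zero_add, mul_one]
      rw [Real.one_le_exp_iff]
      push Not at hw
      nlinarith
  rw [integral_gaussianReal_eq_integral_smul one_ne_zero]
  simp_rw [smul_eq_mul, hdens]
  rw [integral_add ((integrable_gaussianPDFReal _ _).indicator measurableSet_Iic)
    ((integrable_gaussianPDFReal _ _).indicator measurableSet_Ioi),
    integral_indicator measurableSet_Iic, integral_indicator measurableSet_Ioi]
  have key : ∀ (m : ℝ) (S : Set ℝ), ∫ x in S, gaussianPDFReal m 1 x = (gaussianReal m 1).real S := by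
    intro m S
    rw [measureReal_def, gaussianReal_apply_eq_integral _ one_ne_zero, ENNReal.toReal_ofReal]
    exact integral_nonneg fun x => gaussianPDFReal_nonneg _ _ _
  rw [key, key, gaussianReal_real_Iic, gaussianReal_real_Ioi]
  have : c / 2 - c = -c / 2 := by ring
  rw [this, ← neg_div]
  ring

/-- `N(-s/2, s)` is the law of the log-likelihood ratio between `N(0, 1)` and `N(√s, 1)`, under the
former; the degenerate case `s = 0` is included. -/
lemma integral_min_one_exp_gaussianReal {s : ℝ} (hs : 0 ≤ s) :
    ∫ y, min 1 (Real.exp y) ∂gaussianReal (-(s / 2)) s.toNNReal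
      = 2 * stdNormalCDF (-√s / 2) := by
  have h1 := gaussianReal_map_const_mul (μ := 0) (v := 1) (√s)
  have h2 := gaussianReal_map_add_const (μ := √s * 0) (v := .mk (√s ^ 2) (sq_nonneg _) * 1)
    (-(√s ^ 2 / 2))
  rw [← integral_min_one_exp_stdNormal (Real.sqrt_nonneg s)]
  have h3 : gaussianReal (-(s / 2)) s.toNNReal
      = (gaussianReal 0 1).map (fun w => √s * w + -(√s ^ 2 / 2)) := by
    rw [← h1, Measure.map_map (by fun_prop) (by fun_prop)] at h2
    have h4 : ((fun x => x + -(√s ^ 2 / 2)) ∘ fun x => √s * x)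
      = (fun w => √s * w + -(√s ^ 2 / 2)) := rfl
    rw [h4] at h2
    rw [h2]
    congr 1
    · rw [Real.sq_sqrt hs]; ring
    · ext
      simp [Real.sq_sqrt hs, hs]
  rw [h3, integral_map (by fun_prop) (by fun_prop)]

lemma abs_min_one_exp_sub_le (a b : ℝ) :
    |min 1 (Real.exp a) - min 1 (Real.exp b)| ≤ |a - b| := by
  wlog hab : a ≤ b generalizing a b
  · rw [abs_sub_comm, abs_sub_comm a]
    exact this b a (le_of_not_ge hab)
  have hm : ∀ x, min 1 (Real.exp x) = Real.exp (min 0 x) := fun x => by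
    rw [Real.exp_monotone.map_min, Real.exp_zero]
  rw [hm, hm, abs_sub_comm, abs_sub_comm a, abs_of_nonneg (sub_nonneg.2 hab),
    abs_of_nonneg (sub_nonneg.2 (Real.exp_le_exp.2 (min_le_min_left 0 hab)))]
  set a' := min 0 a
  set b' := min 0 b
  have hb0 : b' ≤ 0 := min_le_left _ _
  have hle : b' - a' ≤ b - a := by
    simp only [a', b']
    rcases min_cases 0 a with h | h <;> rcases min_cases 0 b with h' | h' <;> linarith
  have hab' : a' ≤ b' := min_le_min_left 0 hab
  have h1 : Real.exp a' = Real.exp b' * Real.exp (a' - b') := by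
    rw [← Real.exp_add]; congr 1; ring
  have h2 := Real.add_one_le_exp (a' - b')
  have h3 : Real.exp b' ≤ 1 := Real.exp_le_one_iff.2 hb0
  have h4 := Real.exp_pos b'
  rw [h1]
  nlinarith

lemma abs_log_one_add_sub_le {x : ℝ} (hx : |x| ≤ 1 / 2) :
    |Real.log (1 + x) - (x - x ^ 2 / 2)| ≤ 2 * |x| ^ 3 := by
  have h := Real.abs_log_sub_add_sum_range_le (x := -x) (by rw [abs_neg]; linarith) 2
  rw [abs_neg] at h
  have e : (∑ i ∈ Finset.range 2, (-x) ^ (i + 1) / ((i : ℝ) + 1)) + Real.log (1 - -x)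
      = Real.log (1 + x) - (x - x ^ 2 / 2) := by
    simp [Finset.sum_range_succ]; ring
  rw [e] at h
  refine h.trans ?_
  rw [div_le_iff₀ (by linarith)]
  have : 0 ≤ |x| ^ 3 * (1 - 2 * |x|) := mul_nonneg (by positivity) (by linarith)
  norm_num
  linarith

/-- The likelihood ratio `∏ (1 + x i)` may be replaced by the exponential of its second-order
expansion inside the affinity functional. -/
lemma abs_min_one_prod_sub_le {ι : Type*} [Fintype ι] (x : ι → ℝ) (hx : ∀ i, 0 ≤ 1 + x i)
    (s : ℝ) :
    |min 1 (∏ i, (1 + x i)) - min 1 (Real.exp (-(s / 2) + ∑ i, x i))|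
      ≤ |∑ i, x i ^ 2 - s| + 2 * ∑ i, |x i| ^ 3 + 16 * ∑ i, x i ^ 4 := by
  have h3 : 0 ≤ ∑ i, |x i| ^ 3 := Finset.sum_nonneg fun i _ => by positivity
  have h4 : 0 ≤ ∑ i, x i ^ 4 := Finset.sum_nonneg fun i _ => by positivity
  by_cases h : ∀ i, |x i| ≤ 1 / 2
  · have hpos : ∀ i, 0 < 1 + x i := fun i => by linarith [(abs_le.1 (h i)).1]
    have e : ∏ i, (1 + x i) = Real.exp (∑ i, Real.log (1 + x i)) := by
      rw [Real.exp_sum]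
      exact Finset.prod_congr rfl fun i _ => (Real.exp_log (hpos i)).symm
    rw [e]
    refine (abs_min_one_exp_sub_le _ _).trans ?_
    have e2 : ∑ i, Real.log (1 + x i) - (-(s / 2) + ∑ i, x i)
        = ∑ i, (Real.log (1 + x i) - (x i - x i ^ 2 / 2)) - (∑ i, x i ^ 2 - s) / 2 := by
      rw [Finset.sum_sub_distrib, Finset.sum_sub_distrib, ← Finset.sum_div]; ring
    rw [e2]
    refine (abs_sub _ _).trans ?_
    have h5 : |∑ i, (Real.log (1 + x i) - (x i - x i ^ 2 / 2))| ≤ 2 * ∑ i, |x i| ^ 3 := by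
      rw [Finset.mul_sum]
      exact (Finset.abs_sum_le_sum_abs _ _).trans
        (Finset.sum_le_sum fun i _ => abs_log_one_add_sub_le (h i))
    have h6 : |(∑ i, x i ^ 2 - s) / 2| ≤ |∑ i, x i ^ 2 - s| := by
      rw [abs_div, abs_two]; linarith [abs_nonneg (∑ i, x i ^ 2 - s)]
    linarith
  -- a single large coordinate already makes the fourth-moment term exceed the trivial bound `1`
  · push Not at h
    obtain ⟨j, hj⟩ := h
    have h5 : x j ^ 4 ≤ ∑ i, x i ^ 4 :=
      Finset.single_le_sum (f := fun i => x i ^ 4) (fun i _ => by positivity) (Finset.mem_univ j)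
    have h6 : (1 : ℝ) / 16 ≤ x j ^ 4 := by
      have : (1 / 2 : ℝ) ^ 4 ≤ |x j| ^ 4 := by gcongr
      rw [← abs_pow, abs_of_nonneg (by positivity : 0 ≤ x j ^ 4)] at this
      norm_num at this ⊢
      exact this
    have h7 : |min 1 (∏ i, (1 + x i)) - min 1 (Real.exp (-(s / 2) + ∑ i, x i))| ≤ 1 := by
      have hp : 0 ≤ ∏ i, (1 + x i) := Finset.prod_nonneg fun i _ => hx i
      have a1 : 0 ≤ min 1 (∏ i, (1 + x i)) := le_min zero_le_one hp
      have a2 : 0 ≤ min 1 (Real.exp (-(s / 2) + ∑ i, x i)) :=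
        le_min zero_le_one (Real.exp_pos _).le
      have a3 := min_le_left 1 (∏ i, (1 + x i))
      have a4 := min_le_left 1 (Real.exp (-(s / 2) + ∑ i, x i))
      rw [abs_le]; constructor <;> linarith
    linarith [abs_nonneg (∑ i, x i ^ 2 - s)]

section

variable {X : Type*} [MeasurableSpace X]

/-- The sum of squares of independent variables is concentrated around `s`, in mean square. -/
lemma integral_sum_sq_sub_sq_le {n : ℕ} {ν : Fin n → Measure X} [∀ i, IsProbabilityMeasure (ν i)]
    {g : Fin n → X → ℝ} (hg : ∀ i, Measurable (g i))
    (hint : ∀ i, Integrable (fun x => g i x ^ 4) (ν i)) (s : ℝ) :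
    Integrable (fun o : Fin n → X => (∑ i, g i (o i) ^ 2 - s) ^ 2) (Measure.pi ν) ∧
    ∫ o, (∑ i, g i (o i) ^ 2 - s) ^ 2 ∂Measure.pi ν
      ≤ (∑ i, ∫ x, g i x ^ 4 ∂ν i) + (∑ i, ∫ x, g i x ^ 2 ∂ν i - s) ^ 2 := by
  have hL : ∀ i, MemLp (fun x => g i x ^ 2) 2 (ν i) := fun i => by
    rw [memLp_two_iff_integrable_sq ((hg i).pow_const 2).aestronglyMeasurable]
    refine (hint i).congr (ae_of_all _ fun x => ?_)
    simp only; ring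
  have hLpi : ∀ i, MemLp (fun o : Fin n → X => g i (o i) ^ 2) 2 (Measure.pi ν) := fun i =>
    (hL i).comp_measurePreserving (measurePreserving_eval ν i)
  have hLs : MemLp (fun o : Fin n → X => ∑ i, g i (o i) ^ 2) 2 (Measure.pi ν) :=
    memLp_finsetSum _ fun i _ => hLpi i
  have hLc := hLs.sub (memLp_const s)
  have hi := hLc.integrable_sq
  refine ⟨hi, ?_⟩
  have hmean : ∫ o, ∑ i, g i (o i) ^ 2 ∂Measure.pi ν = ∑ i, ∫ x, g i x ^ 2 ∂ν i := by
    rw [integral_finsetSum _ fun i _ => (hLpi i).integrable (by norm_num)]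
    exact Finset.sum_congr rfl fun i _ => integral_comp_eval (μ := ν) (i := i)
      (f := fun x => g i x ^ 2) ((hg i).pow_const 2).aestronglyMeasurable
  have hvar := variance_sum_pi hL
  have e1 : (∑ i, fun ω : Fin n → X => g i (ω i) ^ 2) = fun o => ∑ i, g i (o i) ^ 2 := by
    ext o; simp
  rw [e1, variance_eq_sub hLs] at hvar
  have hle : ∑ i, Var[fun x => g i x ^ 2; ν i] ≤ ∑ i, ∫ x, g i x ^ 4 ∂ν i := by
    refine Finset.sum_le_sum fun i _ => ?_
    rw [variance_eq_sub (hL i)]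
    have : ∫ x, ((fun x => g i x ^ 2) ^ 2) x ∂ν i = ∫ x, g i x ^ 4 ∂ν i :=
      integral_congr_ae (ae_of_all _ fun x => by simp only [Pi.pow_apply]; ring)
    rw [this]
    linarith [sq_nonneg (∫ x, g i x ^ 2 ∂ν i)]
  rw [hmean] at hvar
  have hsq := hLs.integrable_sq
  have e2 : ∫ o, (∑ i, g i (o i) ^ 2 - s) ^ 2 ∂Measure.pi ν
      = (∫ o, (∑ i, g i (o i) ^ 2) ^ 2 ∂Measure.pi ν)
        - 2 * s * (∑ i, ∫ x, g i x ^ 2 ∂ν i) + s ^ 2 := by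
    have : ∀ o : Fin n → X, (∑ i, g i (o i) ^ 2 - s) ^ 2
      = (∑ i, g i (o i) ^ 2) ^ 2 - 2 * s * (∑ i, g i (o i) ^ 2) + s ^ 2 := fun o => by ring
    simp_rw [this]
    have hI := (hLs.integrable (by norm_num)).const_mul (2 * s)
    have hd : Integrable (fun o : Fin n → X => (∑ i, g i (o i) ^ 2) ^ 2
      - 2 * s * (∑ i, g i (o i) ^ 2)) (Measure.pi ν) := hsq.sub hI
    rw [integral_add hd (integrable_const _), integral_sub hsq hI, integral_const_mul, hmean]
    simp
  have e3 : ∫ o, ((fun o : Fin n → X => ∑ i, g i (o i) ^ 2) ^ 2) o ∂Measure.pi ν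
    = ∫ o, (∑ i, g i (o i) ^ 2) ^ 2 ∂Measure.pi ν := rfl
  rw [e3] at hvar
  rw [e2]
  nlinarith

variable {N : ℕ → ℕ} {ν : ∀ k, Fin (N k) → Measure X}
  [∀ k i, IsProbabilityMeasure (ν k i)] {g : ∀ k, Fin (N k) → X → ℝ} {s : ℝ}

lemma measurable_sum_eval {n : ℕ} {g : Fin n → X → ℝ} (hg : ∀ i, Measurable (g i)) :
    Measurable fun o : Fin n → X => ∑ i, g i (o i) :=
  Finset.measurable_sum _ fun i _ => (hg i).comp (measurable_pi_apply i)

lemma IsLyapunovArray.tendsto_integral_exp (h : IsLyapunovArray ν g s) :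
    Tendsto (fun k => ∫ o, min 1 (Real.exp (-(s / 2) + ∑ i, g k i (o i))) ∂Measure.pi (ν k)) atTop
      (𝓝 (2 * stdNormalCDF (-√s / 2))) := by
  have hm : ∀ k, Measurable fun o : Fin (N k) → X => -(s / 2) + ∑ i, g k i (o i) :=
    fun k => measurable_const.add (measurable_sum_eval (h.measurable k))
  let P : ℕ → ProbabilityMeasure ℝ := fun k =>
    ⟨(Measure.pi (ν k)).map (fun o => -(s / 2) + ∑ i, g k i (o i)),
      Measure.isProbabilityMeasure_map (hm k).aemeasurable⟩
  let G : ProbabilityMeasure ℝ := ⟨gaussianReal (-(s / 2)) s.toNNReal, inferInstance⟩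
  have hP : Tendsto P atTop (𝓝 G) :=
    h.tendsto_gaussianReal (b := fun _ => -(s / 2)) tendsto_const_nhds (fun k => rfl) rfl
  rw [ProbabilityMeasure.tendsto_iff_forall_integral_tendsto] at hP
  let f : BoundedContinuousFunction ℝ ℝ := BoundedContinuousFunction.ofNormedAddCommGroup
    (fun y => min 1 (Real.exp y)) (by fun_prop) 1 (fun y => by
      rw [Real.norm_eq_abs, abs_of_nonneg (le_min zero_le_one (Real.exp_pos _).le)]
      exact min_le_left _ _)
  have hf := hP f
  have e1 : ∫ y, f y ∂gaussianReal (-(s / 2)) s.toNNReal = 2 * stdNormalCDF (-√s / 2) :=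
    integral_min_one_exp_gaussianReal h.limit_nonneg
  have e2 : ∀ k, ∫ y, f y ∂(P k : Measure ℝ)
      = ∫ o, min 1 (Real.exp (-(s / 2) + ∑ i, g k i (o i))) ∂Measure.pi (ν k) := fun k =>
    integral_map (hm k).aemeasurable f.continuous.aestronglyMeasurable
  simp_rw [e2] at hf
  rw [← e1]
  exact hf

/-- The affinity between a product measure and the product of the perturbed measures with densities
`1 + g k i` converges to the affinity of two normal laws. -/
theorem IsLyapunovArray.tendsto_integral_min_one_prod (h : IsLyapunovArray ν g s)
    (hpos : ∀ᶠ k in atTop, ∀ i x, 0 ≤ 1 + g k i x) :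
    Tendsto (fun k => ∫ o, min 1 (∏ i, (1 + g k i (o i))) ∂Measure.pi (ν k)) atTop
      (𝓝 (2 * stdNormalCDF (-√s / 2))) := by
  refine (tendsto_iff_of_dist ?_).2 h.tendsto_integral_exp
  simp only [Real.dist_eq]
  refine tendsto_zero_of_forall_eta (1 + 2 * s)
    (fun η k => η + ((∑ i, ∫ x, g k i x ^ 4 ∂ν k i)
        + (∑ i, ∫ x, g k i x ^ 2 ∂ν k i - s) ^ 2) / η
      + 2 * (η * (∑ i, ∫ x, g k i x ^ 2 ∂ν k i) + (∑ i, ∫ x, g k i x ^ 4 ∂ν k i) / η)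
      + 16 * ∑ i, ∫ x, g k i x ^ 4 ∂ν k i)
    (fun _ => abs_nonneg _) (fun η hη => ?_) (fun η hη => ?_)
  · filter_upwards [h.integrable, hpos] with k hint hpos
    have hg := h.measurable k
    have hev : ∀ (f : Fin (N k) → X → ℝ), (∀ i, Measurable (f i)) →
        (∀ i, Integrable (f i) (ν k i)) →
        Integrable (fun o : Fin (N k) → X => ∑ i, f i (o i)) (Measure.pi (ν k)) ∧
        ∫ o, ∑ i, f i (o i) ∂Measure.pi (ν k) = ∑ i, ∫ x, f i x ∂ν k i := by
      intro f hf hfi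
      have := fun i => integrable_comp_eval (μ := ν k) (hfi i)
      refine ⟨integrable_finsetSum _ fun i _ => this i, ?_⟩
      rw [integral_finsetSum _ fun i _ => this i]
      exact Finset.sum_congr rfl fun i _ => integral_comp_eval (hf i).aestronglyMeasurable
    obtain ⟨i4, e4⟩ := hev (fun i x => g k i x ^ 4) (fun i => (hg i).pow_const 4) hint
    obtain ⟨i2, e2⟩ := hev (fun i x => g k i x ^ 2) (fun i => (hg i).pow_const 2)
      (fun i => integrable_sq_of_integrable_pow (hg i) (hint i))
    obtain ⟨iv, ev⟩ := integral_sum_sq_sub_sq_le hg hint s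
    have hb1 : Measurable fun o : Fin (N k) → X => min 1 (∏ i, (1 + g k i (o i))) :=
      measurable_const.min (Finset.measurable_prod _ fun i _ =>
        measurable_const.add ((hg i).comp (measurable_pi_apply i)))
    have hb2 : Measurable fun o : Fin (N k) → X =>
        min 1 (Real.exp (-(s / 2) + ∑ i, g k i (o i))) :=
      measurable_const.min (measurable_const.add (measurable_sum_eval hg)).exp
    have hI1 : Integrable (fun o : Fin (N k) → X => min 1 (∏ i, (1 + g k i (o i))))
        (Measure.pi (ν k)) := by
      refine Integrable.of_bound hb1.aestronglyMeasurable 1 (ae_of_all _ fun o => ?_)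
      rw [Real.norm_eq_abs, abs_of_nonneg
        (le_min zero_le_one (Finset.prod_nonneg fun i _ => hpos i (o i)))]
      exact min_le_left _ _
    have hI2 : Integrable (fun o : Fin (N k) → X =>
        min 1 (Real.exp (-(s / 2) + ∑ i, g k i (o i)))) (Measure.pi (ν k)) := by
      refine Integrable.of_bound hb2.aestronglyMeasurable 1 (ae_of_all _ fun o => ?_)
      rw [Real.norm_eq_abs, abs_of_nonneg (le_min zero_le_one (Real.exp_pos _).le)]
      exact min_le_left _ _
    rw [← integral_sub hI1 hI2]
    have hbound : ∀ o : Fin (N k) → X, ‖min 1 (∏ i, (1 + g k i (o i)))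
        - min 1 (Real.exp (-(s / 2) + ∑ i, g k i (o i)))‖
        ≤ η + (∑ i, g k i (o i) ^ 2 - s) ^ 2 / η
          + 2 * (η * (∑ i, g k i (o i) ^ 2) + (∑ i, g k i (o i) ^ 4) / η)
          + 16 * ∑ i, g k i (o i) ^ 4 := by
      intro o
      rw [Real.norm_eq_abs]
      refine (abs_min_one_prod_sub_le _ (fun i => hpos i (o i)) s).trans ?_
      have h1 : |∑ i, g k i (o i) ^ 2 - s| ≤ η + (∑ i, g k i (o i) ^ 2 - s) ^ 2 / η := by
        set y := ∑ i, g k i (o i) ^ 2 - s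
        rw [← sq_abs y]
        have e : η + |y| ^ 2 / η - |y| = ((η - |y|) ^ 2 + η * |y|) / η := by field_simp; ring
        have : 0 ≤ ((η - |y|) ^ 2 + η * |y|) / η := by positivity
        linarith
      have h2 : ∑ i, |g k i (o i)| ^ 3
          ≤ η * (∑ i, g k i (o i) ^ 2) + (∑ i, g k i (o i) ^ 4) / η := by
        rw [Finset.mul_sum, Finset.sum_div, ← Finset.sum_add_distrib]
        exact Finset.sum_le_sum fun i _ => abs_pow_three_le _ hη
      linarith
    have j1 : Integrable (fun o : Fin (N k) → X => η + (∑ i, g k i (o i) ^ 2 - s) ^ 2 / η)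
        (Measure.pi (ν k)) := (integrable_const _).add (iv.div_const _)
    have j2' : Integrable (fun o : Fin (N k) → X =>
        η * (∑ i, g k i (o i) ^ 2) + (∑ i, g k i (o i) ^ 4) / η)
        (Measure.pi (ν k)) := (i2.const_mul _).add (i4.div_const _)
    have j2 := j2'.const_mul 2
    have j3 : Integrable (fun o : Fin (N k) → X => η + (∑ i, g k i (o i) ^ 2 - s) ^ 2 / η
          + 2 * (η * (∑ i, g k i (o i) ^ 2) + (∑ i, g k i (o i) ^ 4) / η))
        (Measure.pi (ν k)) := j1.add j2
    refine (norm_integral_le_of_norm_le (j3.add (i4.const_mul 16))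
      (ae_of_all _ hbound)).trans ?_
    simp only [Pi.add_apply]
    rw [integral_add j3 (i4.const_mul 16), integral_add j1 j2,
      integral_add (integrable_const _) (iv.div_const _), integral_const_mul, integral_const_mul,
      integral_add (i2.const_mul _) (i4.div_const _), integral_const_mul, integral_div,
      integral_div, e2, e4]
    have := div_le_div_of_nonneg_right ev hη.le
    simp only [integral_const, probReal_univ, one_smul]
    linarith
  · have hv0 : Tendsto (fun k => (∑ i, ∫ x, g k i x ^ 2 ∂ν k i - s) ^ 2) atTop (𝓝 0) := by
      have := (h.variance.sub_const s).pow 2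
      simpa using this
    have := ((((h.fourth.add hv0).div_const η).const_add η).add
      (((h.variance.const_mul η).add (h.fourth.div_const η)).const_mul 2)).add
      (h.fourth.const_mul 16)
    convert this using 2
    simp; ring

/-- Lower tail probabilities of row sums of a normalized Lyapunov array with converging shifts. -/
theorem IsLyapunovArray.tendsto_measureReal (h : IsLyapunovArray ν g 1) {b : ℕ → ℝ} {β : ℝ}
    (hb : Tendsto b atTop (𝓝 β)) :
    Tendsto (fun k => (Measure.pi (ν k)).real {o | b k + ∑ i, g k i (o i) ≤ 0}) atTop
      (𝓝 (stdNormalCDF (-β))) := by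
  have hm : ∀ k, Measurable fun o : Fin (N k) → X => b k + ∑ i, g k i (o i) :=
    fun k => measurable_const.add (measurable_sum_eval (h.measurable k))
  let P : ℕ → ProbabilityMeasure ℝ := fun k =>
    ⟨(Measure.pi (ν k)).map (fun o => b k + ∑ i, g k i (o i)),
      Measure.isProbabilityMeasure_map (hm k).aemeasurable⟩
  let G : ProbabilityMeasure ℝ := ⟨gaussianReal β (1 : ℝ).toNNReal, inferInstance⟩
  have hP : Tendsto P atTop (𝓝 G) := h.tendsto_gaussianReal hb (fun k => rfl) rfl
  have : NullSingletonClass (gaussianReal β 1) := nullSingletonClass_gaussianReal one_ne_zero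
  have hlim := ProbabilityMeasure.tendsto_measure_of_null_frontier_of_tendsto' hP
    (E := Set.Iic 0) (by simp [G])
  have hlim' := (ENNReal.tendsto_toReal (measure_ne_top (G : Measure ℝ) _)).comp hlim
  have e : (gaussianReal β (1 : ℝ).toNNReal).real (Set.Iic 0) = stdNormalCDF (-β) := by
    rw [Real.toNNReal_one, gaussianReal_real_Iic, zero_sub]
  rw [← e]
  refine hlim'.congr fun k => ?_
  change ((Measure.pi (ν k)).map (fun o => b k + ∑ i, g k i (o i))).real (Set.Iic 0) = _
  rw [map_measureReal_apply (hm k) measurableSet_Iic]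
  rfl

end

/-! ### Poisson moments -/

section PoissonMoments

open scoped NNReal

/-- The Stein–Chen identity for the Poisson law. -/
lemma integral_natCast_mul_poissonMeasure (r : ℝ≥0) (g : ℕ → ℝ) :
    ∫ x, (x : ℝ) * g x ∂poissonMeasure r = r * ∫ x, g (x + 1) ∂poissonMeasure r := by
  rw [integral_poissonMeasure, integral_poissonMeasure, ← tsum_mul_left]
  have hinj : Function.Injective (fun n : ℕ => n + 1) := add_left_injective 1
  rw [← hinj.tsum_eq]
  · refine tsum_congr fun n => ?_
    have : (n.factorial : ℝ) ≠ 0 := by positivity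
    have : (n : ℝ) + 1 ≠ 0 := by positivity
    simp only [smul_eq_mul, Nat.factorial_succ]
    push_cast
    rw [pow_succ]
    field_simp
  · intro n hn
    rcases n with _ | n
    · simp at hn
    · exact ⟨n, rfl⟩

lemma integrable_natCast_mul_poissonMeasure {r : ℝ≥0} {g : ℕ → ℝ}
    (hg : Integrable (fun x => g (x + 1)) (poissonMeasure r)) :
    Integrable (fun x : ℕ => (x : ℝ) * g x) (poissonMeasure r) := by
  rw [integrable_poissonMeasure_iff] at hg ⊢
  rw [← summable_nat_add_iff 1]
  refine (hg.mul_left (r : ℝ)).congr fun n => ?_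
  have : (n.factorial : ℝ) ≠ 0 := by positivity
  have : (n : ℝ) + 1 ≠ 0 := by positivity
  simp only [norm_mul, Nat.factorial_succ, Real.norm_eq_abs]
  rw [abs_of_nonneg (by positivity : (0 : ℝ) ≤ ((n + 1 : ℕ) : ℝ))]
  push_cast
  rw [pow_succ]
  field_simp

lemma hasSum_pow_poissonMeasure (r : ℝ≥0) (a : ℝ) :
    HasSum (fun n : ℕ => Real.exp (-r) * r ^ n / n.factorial * a ^ n)
      (Real.exp (r * (a - 1))) := by
  have h := (NormedSpace.expSeries_div_hasSum_exp (𝔸 := ℝ) (r * a)).mul_left (Real.exp (-r))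
  rw [← Real.exp_eq_exp_ℝ, ← Real.exp_add] at h
  rw [show -(r : ℝ) + r * a = r * (a - 1) by ring] at h
  have e : (fun n : ℕ => Real.exp (-r) * ((r * a) ^ n / n.factorial))
      = fun n : ℕ => Real.exp (-r) * r ^ n / n.factorial * a ^ n := by
    ext n; rw [mul_pow]; ring
  rw [← e]
  exact h

lemma integrable_pow_poissonMeasure (r : ℝ≥0) (a : ℝ) :
    Integrable (fun n : ℕ => a ^ n) (poissonMeasure r) := by
  rw [integrable_poissonMeasure_iff]
  simp_rw [norm_pow]
  exact (hasSum_pow_poissonMeasure r ‖a‖).summable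

lemma integral_pow_poissonMeasure (r : ℝ≥0) (a : ℝ) :
    ∫ n, a ^ n ∂poissonMeasure r = Real.exp (r * (a - 1)) := by
  rw [integral_poissonMeasure]
  exact (hasSum_pow_poissonMeasure r a).tsum_eq

lemma integrable_descFactorial_poissonMeasure (r : ℝ≥0) (k : ℕ) :
    Integrable (fun x : ℕ => (x.descFactorial k : ℝ)) (poissonMeasure r) := by
  induction k with
  | zero => simp
  | succ k ih =>
    have : (fun x : ℕ => (x.descFactorial (k + 1) : ℝ))
        = fun x : ℕ => (x : ℝ) * ((x - 1).descFactorial k : ℝ) := by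
      ext x
      rcases x with _ | x
      · simp
      · rw [Nat.succ_descFactorial_succ]; simp
    rw [this]
    exact integrable_natCast_mul_poissonMeasure (by simpa using ih)

lemma integral_descFactorial_poissonMeasure (r : ℝ≥0) (k : ℕ) :
    ∫ x, (x.descFactorial k : ℝ) ∂poissonMeasure r = r ^ k := by
  induction k with
  | zero => simp
  | succ k ih =>
    have : (fun x : ℕ => (x.descFactorial (k + 1) : ℝ))
        = fun x : ℕ => (x : ℝ) * ((x - 1).descFactorial k : ℝ) := by
      ext x
      rcases x with _ | x
      · simp
      · rw [Nat.succ_descFactorial_succ]; simp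
    rw [this, integral_natCast_mul_poissonMeasure]
    simp only [add_tsub_cancel_right]
    rw [ih]; ring

lemma cast_descFactorial_succ (x k : ℕ) :
    ((x.descFactorial (k + 1) : ℕ) : ℝ) = ((x : ℝ) - k) * (x.descFactorial k : ℝ) := by
  rw [Nat.descFactorial_succ, Nat.cast_mul]
  rcases le_or_gt k x with h | h
  · rw [Nat.cast_sub h]
  · rw [Nat.descFactorial_of_lt h]; simp

/-- The centred quadratic statistic of one count: `(x - lam)² - x` minus its mean under the
Poisson law with mean `r`. -/
noncomputable def quadStat (lam r : ℝ) (x : ℕ) : ℝ := ((x : ℝ) - lam) ^ 2 - x - (r - lam) ^ 2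

lemma quadStat_eq (lam r : ℝ) (x : ℕ) :
    quadStat lam r x = (x.descFactorial 2 : ℝ) + (-2 * lam) * (x.descFactorial 1 : ℝ)
      + (lam ^ 2 - (r - lam) ^ 2) := by
  simp only [quadStat, cast_descFactorial_succ, Nat.descFactorial_zero]
  push_cast
  ring

lemma integral_quadStat (lam : ℝ) (r : ℝ≥0) :
    ∫ x, quadStat lam r x ∂poissonMeasure r = 0 := by
  have h := integrable_descFactorial_poissonMeasure r
  simp_rw [quadStat_eq]
  have h1 : Integrable (fun x : ℕ => (x.descFactorial 2 : ℝ)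
      + (-2 * lam) * (x.descFactorial 1 : ℝ)) (poissonMeasure r) := (h 2).add ((h 1).const_mul _)
  rw [integral_add h1 (integrable_const _), integral_add (h 2) ((h 1).const_mul _),
    integral_const_mul, integral_descFactorial_poissonMeasure,
    integral_descFactorial_poissonMeasure]
  simp
  ring

lemma integral_quadStat_sq (lam : ℝ) (r : ℝ≥0) :
    ∫ x, quadStat lam r x ^ 2 ∂poissonMeasure r = 2 * r ^ 2 + 4 * (r - lam) ^ 2 * r := by
  have h := integrable_descFactorial_poissonMeasure r
  set c := lam ^ 2 - ((r : ℝ) - lam) ^ 2 with hc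
  -- expansion in falling factorials, whose Poisson means are powers of `r`
  have e : ∀ x, quadStat lam r x ^ 2 = (x.descFactorial 4 : ℝ)
      + (4 - 4 * lam) * (x.descFactorial 3 : ℝ)
      + (2 - 8 * lam + 4 * lam ^ 2 + 2 * c) * (x.descFactorial 2 : ℝ)
      + (4 * lam ^ 2 - 4 * lam * c) * (x.descFactorial 1 : ℝ) + c ^ 2 := by
    intro x
    rw [quadStat_eq, ← hc]
    simp only [cast_descFactorial_succ, Nat.descFactorial_zero]
    push_cast
    ring
  simp_rw [e]
  have h1 : Integrable (fun x : ℕ => (x.descFactorial 4 : ℝ)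
      + (4 - 4 * lam) * (x.descFactorial 3 : ℝ)) (poissonMeasure r) :=
    (h 4).add ((h 3).const_mul _)
  have h2 : Integrable (fun x : ℕ => (x.descFactorial 4 : ℝ)
      + (4 - 4 * lam) * (x.descFactorial 3 : ℝ)
      + (2 - 8 * lam + 4 * lam ^ 2 + 2 * c) * (x.descFactorial 2 : ℝ)) (poissonMeasure r) :=
    h1.add ((h 2).const_mul _)
  have h3 : Integrable (fun x : ℕ => (x.descFactorial 4 : ℝ)
      + (4 - 4 * lam) * (x.descFactorial 3 : ℝ)
      + (2 - 8 * lam + 4 * lam ^ 2 + 2 * c) * (x.descFactorial 2 : ℝ)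
      + (4 * lam ^ 2 - 4 * lam * c) * (x.descFactorial 1 : ℝ)) (poissonMeasure r) :=
    h2.add ((h 1).const_mul _)
  rw [integral_add h3 (integrable_const _), integral_add h2 ((h 1).const_mul _),
    integral_add h1 ((h 2).const_mul _), integral_add (h 4) ((h 3).const_mul _)]
  simp only [integral_const_mul, integral_descFactorial_poissonMeasure]
  simp only [integral_const, probReal_univ, one_smul, hc]
  ring

/-- A common envelope for the quadratic statistic and for the likelihood ratio of one count. Its
fourth moment is of order `lam ^ 2`, since the second term vanishes for `x = 0` and `x = 1`. -/
noncomputable def envelope (lam : ℝ) (x : ℕ) : ℝ := lam + (x : ℝ) * ((x : ℝ) - 1) * 2 ^ x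

lemma natCast_mul_sub_one_nonneg (x : ℕ) : 0 ≤ (x : ℝ) * ((x : ℝ) - 1) := by
  rcases x with _ | x
  · simp
  · push_cast
    rw [add_sub_cancel_right]
    positivity

lemma envelope_fourth_moment {M lam : ℝ} {r : ℝ≥0} (hl : 0 ≤ lam) (hM : lam ≤ M)
    (hr : (r : ℝ) ≤ 2 * lam) :
    Integrable (fun x => envelope lam x ^ 4) (poissonMeasure r) ∧
    ∫ x, envelope lam x ^ 4 ∂poissonMeasure r
      ≤ 8 * (M ^ 2 + 8192 * Real.exp (2046 * M)) * lam ^ 2 := by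
  -- the fourth power of the second term is `x (x - 1)` times a factor of exponential growth, so two
  -- applications of the Stein–Chen identity extract `r ^ 2`
  let g2 : ℕ → ℝ := fun x => ((x : ℝ) + 1) ^ 3 * (x : ℝ) ^ 3 * 16 ^ (x + 1)
  let g1 : ℕ → ℝ := fun x => ((x : ℝ) - 1) * ((x : ℝ) ^ 3 * ((x : ℝ) - 1) ^ 3 * 16 ^ x)
  have hg1 : ∀ x : ℕ, g1 (x + 1) = x * g2 x := fun x => by
    simp only [g1, g2]; push_cast; ring
  have ht : ∀ x : ℕ, ((x : ℝ) * ((x : ℝ) - 1) * 2 ^ x) ^ 4 = x * g1 x := fun x => by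
    simp only [g1]
    rw [mul_pow, ← pow_mul, mul_comm x 4, pow_mul]
    norm_num
    ring
  have hg2n : ∀ x : ℕ, 0 ≤ g2 x := fun x => by simp only [g2]; positivity
  have hg2 : ∀ x : ℕ, g2 (x + 1) ≤ 2048 * 1024 ^ x := by
    intro x
    have h1 : ((x : ℝ) + 1) ≤ 2 ^ x := by
      have := Nat.lt_two_pow_self (n := x)
      exact_mod_cast this
    have h2 : ((x : ℝ) + 1 + 1) ≤ 2 ^ (x + 1) := by
      have := Nat.lt_two_pow_self (n := x + 1)
      exact_mod_cast this
    have e : (2048 : ℝ) * 1024 ^ x = (2 ^ (x + 1)) ^ 3 * (2 ^ x) ^ 3 * 16 ^ (x + 1 + 1) := by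
      have : (1024 : ℝ) ^ x = (2 ^ x) ^ 6 * 16 ^ x := by
        rw [← pow_mul, mul_comm x 6, pow_mul, ← mul_pow]; norm_num
      rw [this]; ring
    rw [e]
    simp only [g2]
    push_cast
    gcongr
  have i2 : Integrable (fun x => g2 (x + 1)) (poissonMeasure r) :=
    ((integrable_pow_poissonMeasure r 1024).const_mul 2048).mono' .of_discrete
      (ae_of_all _ fun x => by
        rw [Real.norm_eq_abs, abs_of_nonneg (hg2n _)]; exact hg2 x)
  have i1 : Integrable (fun x => g1 (x + 1)) (poissonMeasure r) := by
    simp_rw [hg1]; exact integrable_natCast_mul_poissonMeasure i2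
  have it : Integrable (fun x : ℕ => ((x : ℝ) * ((x : ℝ) - 1) * 2 ^ x) ^ 4)
      (poissonMeasure r) := by
    simp_rw [ht]; exact integrable_natCast_mul_poissonMeasure i1
  have hpt : ∀ x, envelope lam x ^ 4
      ≤ 8 * (lam ^ 4 + ((x : ℝ) * ((x : ℝ) - 1) * 2 ^ x) ^ 4) := by
    intro x
    rw [envelope]
    set t := (x : ℝ) * ((x : ℝ) - 1) * 2 ^ x
    have h1 : (lam + t) ^ 2 ≤ 2 * (lam ^ 2 + t ^ 2) := by nlinarith [sq_nonneg (lam - t)]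
    have h2 : (lam ^ 2 + t ^ 2) ^ 2 ≤ 2 * (lam ^ 4 + t ^ 4) := by
      nlinarith [sq_nonneg (lam ^ 2 - t ^ 2)]
    calc (lam + t) ^ 4 = ((lam + t) ^ 2) ^ 2 := by ring
      _ ≤ (2 * (lam ^ 2 + t ^ 2)) ^ 2 := by gcongr
      _ ≤ _ := by nlinarith
  have ib : Integrable (fun x : ℕ => 8 * (lam ^ 4 + ((x : ℝ) * ((x : ℝ) - 1) * 2 ^ x) ^ 4))
      (poissonMeasure r) := ((integrable_const _).add it).const_mul 8
  have i4 : Integrable (fun x => envelope lam x ^ 4) (poissonMeasure r) :=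
    ib.mono' .of_discrete (ae_of_all _ fun x => by
      rw [Real.norm_eq_abs, abs_of_nonneg (by positivity)]; exact hpt x)
  refine ⟨i4, (integral_mono i4 ib hpt).trans ?_⟩
  rw [integral_const_mul, integral_add (integrable_const _) it]
  simp_rw [ht]
  rw [integral_natCast_mul_poissonMeasure]
  simp_rw [hg1]
  rw [integral_natCast_mul_poissonMeasure]
  have hI : ∫ x, g2 (x + 1) ∂poissonMeasure r ≤ 2048 * Real.exp (2046 * M) := by
    refine (integral_mono i2 ((integrable_pow_poissonMeasure r 1024).const_mul 2048) hg2).trans ?_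
    rw [integral_const_mul, integral_pow_poissonMeasure]
    exact mul_le_mul_of_nonneg_left (Real.exp_le_exp.2 (by linarith)) (by norm_num)
  have hI0 : 0 ≤ ∫ x, g2 (x + 1) ∂poissonMeasure r := integral_nonneg fun x => hg2n _
  have hr2 : (r : ℝ) ^ 2 ≤ 4 * lam ^ 2 := by
    have : (r : ℝ) ^ 2 ≤ (2 * lam) ^ 2 := by gcongr
    linarith
  have hl4 : lam ^ 4 ≤ M ^ 2 * lam ^ 2 := by
    have : lam ^ 2 ≤ M ^ 2 := by gcongr
    nlinarith [sq_nonneg lam]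
  have hp : (r : ℝ) * (r * ∫ x, g2 (x + 1) ∂poissonMeasure r)
      ≤ 4 * lam ^ 2 * (2048 * Real.exp (2046 * M)) := by
    rw [← mul_assoc, ← sq]
    exact mul_le_mul hr2 hI hI0 (by positivity)
  simp only [integral_const, probReal_univ, one_smul]
  linarith

lemma abs_quadStat_le {M lam r : ℝ} (hl : 0 ≤ lam) (hM : lam ≤ M)
    (hr : |r - lam| ≤ lam) (x : ℕ) : |quadStat lam r x| ≤ (2 * M + 2) * envelope lam x := by
  have h0 := natCast_mul_sub_one_nonneg x
  have hx : (x : ℝ) ≤ 1 + (x : ℝ) * ((x : ℝ) - 1) := by nlinarith [sq_nonneg ((x : ℝ) - 1)]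
  have h2 : (1 : ℝ) ≤ 2 ^ x := one_le_pow₀ (by norm_num)
  have ht : (x : ℝ) * ((x : ℝ) - 1) ≤ (x : ℝ) * ((x : ℝ) - 1) * 2 ^ x :=
    le_mul_of_one_le_right h0 h2
  have e : quadStat lam r x = (x : ℝ) * ((x : ℝ) - 1) - 2 * (lam * x)
      + (lam ^ 2 - (r - lam) ^ 2) := by rw [quadStat]; ring
  have hs : (r - lam) ^ 2 ≤ lam ^ 2 := sq_le_sq.2 (by rwa [abs_of_nonneg hl])
  have hs' := sq_nonneg (r - lam)
  have hl2 : lam ^ 2 ≤ M * lam := by nlinarith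
  rw [envelope, e]
  set w := (x : ℝ) * ((x : ℝ) - 1)
  set t := w * 2 ^ x
  have hx0 : (0 : ℝ) ≤ x := Nat.cast_nonneg x
  have hlx : lam * x ≤ lam + M * t := by nlinarith
  have hlx0 : 0 ≤ lam * x := by positivity
  have hM0 : 0 ≤ M := hl.trans hM
  have hMt : 0 ≤ M * t := by nlinarith
  have hMl : 0 ≤ M * lam := by positivity
  rw [abs_le]
  constructor <;> nlinarith

lemma quadStat_fourth_moment {M lam : ℝ} {r : ℝ≥0} (hl : 0 ≤ lam) (hM : lam ≤ M)
    (hr : |(r : ℝ) - lam| ≤ lam) :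
    Integrable (fun x => quadStat lam r x ^ 4) (poissonMeasure r) ∧
    ∫ x, quadStat lam r x ^ 4 ∂poissonMeasure r
      ≤ (2 * M + 2) ^ 4 * (8 * (M ^ 2 + 8192 * Real.exp (2046 * M)) * lam ^ 2) := by
  obtain ⟨hi, hb⟩ := envelope_fourth_moment hl hM (r := r) (by linarith [(abs_le.1 hr).2])
  have hpt : ∀ x, quadStat lam r x ^ 4 ≤ (2 * M + 2) ^ 4 * envelope lam x ^ 4 := fun x => by
    rw [← mul_pow, ← abs_of_nonneg (by positivity : 0 ≤ quadStat lam r x ^ 4), abs_pow]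
    exact pow_le_pow_left₀ (abs_nonneg _) (abs_quadStat_le hl hM hr x) 4
  have i4 : Integrable (fun x => quadStat lam r x ^ 4) (poissonMeasure r) :=
    (hi.const_mul _).mono' .of_discrete (ae_of_all _ fun x => by
      rw [Real.norm_eq_abs, abs_of_nonneg (by positivity)]; exact hpt x)
  refine ⟨i4, (integral_mono i4 (hi.const_mul _) hpt).trans ?_⟩
  rw [integral_const_mul]
  gcongr

/-! ### The mixture likelihood ratio of one count -/

/-- The density, with respect to the Poisson law of mean `lam`, of the equal mixture of the Poisson
laws of means `lam * (1 + δ)` and `lam * (1 - δ)`. -/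
noncomputable def mixtureRatio (lam δ : ℝ) (x : ℕ) : ℝ :=
  (Real.exp (-(lam * δ)) * (1 + δ) ^ x + Real.exp (lam * δ) * (1 - δ) ^ x) / 2

lemma mixtureRatio_nonneg {lam δ : ℝ} (h0 : 0 ≤ δ) (h1 : δ ≤ 1) (x : ℕ) :
    0 ≤ mixtureRatio lam δ x := by
  have : 0 ≤ 1 - δ := by linarith
  rw [mixtureRatio]; positivity

lemma integrable_mixtureRatio (r : ℝ≥0) (lam δ : ℝ) :
    Integrable (mixtureRatio lam δ) (poissonMeasure r) :=
  (((integrable_pow_poissonMeasure r _).const_mul _).add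
    ((integrable_pow_poissonMeasure r _).const_mul _)).div_const 2

lemma integral_mixtureRatio (r : ℝ≥0) (δ : ℝ) :
    ∫ x, mixtureRatio r δ x ∂poissonMeasure r = 1 := by
  have h := integrable_pow_poissonMeasure r
  simp only [mixtureRatio]
  rw [integral_div, integral_add ((h _).const_mul _) ((h _).const_mul _), integral_const_mul,
    integral_const_mul, integral_pow_poissonMeasure, integral_pow_poissonMeasure,
    ← Real.exp_add, ← Real.exp_add]
  ring_nf
  norm_num

/-- The chi-square divergence of the mixture from the Poisson law. -/
lemma integral_mixtureRatio_sub_one_sq (r : ℝ≥0) (δ : ℝ) :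
    ∫ x, (mixtureRatio r δ x - 1) ^ 2 ∂poissonMeasure r = Real.cosh (r * δ ^ 2) - 1 := by
  have h := integrable_pow_poissonMeasure r
  have hm := integrable_mixtureRatio r r δ
  have e : ∀ x, (mixtureRatio r δ x - 1) ^ 2
      = (Real.exp (-(r * δ)) ^ 2 / 4 * ((1 + δ) ^ 2) ^ x + 1 / 2 * ((1 + δ) * (1 - δ)) ^ x
        + Real.exp (r * δ) ^ 2 / 4 * ((1 - δ) ^ 2) ^ x) - (2 * mixtureRatio r δ x - 1) := by
    intro x
    have hx : Real.exp (-(r * δ)) * Real.exp (r * δ) = 1 := by rw [← Real.exp_add]; simp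
    rw [mul_pow, ← pow_mul, mul_comm 2 x, pow_mul, ← pow_mul (1 - δ), mul_comm 2 x, pow_mul]
    simp only [mixtureRatio]
    linear_combination ((1 + δ) ^ x * (1 - δ) ^ x / 2) * hx
  simp_rw [e]
  have h1 : Integrable (fun x : ℕ => Real.exp (-(r * δ)) ^ 2 / 4 * ((1 + δ) ^ 2) ^ x
      + 1 / 2 * ((1 + δ) * (1 - δ)) ^ x) (poissonMeasure r) :=
    ((h _).const_mul _).add ((h _).const_mul _)
  have h2 : Integrable (fun x : ℕ => Real.exp (-(r * δ)) ^ 2 / 4 * ((1 + δ) ^ 2) ^ x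
      + 1 / 2 * ((1 + δ) * (1 - δ)) ^ x
      + Real.exp (r * δ) ^ 2 / 4 * ((1 - δ) ^ 2) ^ x) (poissonMeasure r) :=
    h1.add ((h _).const_mul _)
  have h3 : Integrable (fun x : ℕ => 2 * mixtureRatio r δ x - 1) (poissonMeasure r) :=
    (hm.const_mul 2).sub (integrable_const _)
  rw [integral_sub h2 h3, integral_add h1 ((h _).const_mul _),
    integral_add ((h _).const_mul _) ((h _).const_mul _),
    integral_sub (hm.const_mul 2) (integrable_const _)]
  simp only [integral_const_mul, integral_pow_poissonMeasure, integral_mixtureRatio]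
  simp only [integral_const, probReal_univ, one_smul]
  have e1 : Real.exp (-(r * δ)) ^ 2 * Real.exp (r * ((1 + δ) ^ 2 - 1)) = Real.exp (r * δ ^ 2) := by
    rw [← Real.exp_nat_mul, ← Real.exp_add]; congr 1; push_cast; ring
  have e2 : Real.exp (r * δ) ^ 2 * Real.exp (r * ((1 - δ) ^ 2 - 1)) = Real.exp (r * δ ^ 2) := by
    rw [← Real.exp_nat_mul, ← Real.exp_add]; congr 1; push_cast; ring
  have e3 : Real.exp (r * ((1 + δ) * (1 - δ) - 1)) = Real.exp (-(r * δ ^ 2)) := by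
    congr 1; ring
  rw [Real.cosh_eq, e3]
  linear_combination (1 / 4) * e1 + (1 / 4) * e2

lemma abs_one_add_pow_sub_le {d : ℝ} (hd : |d| ≤ 1) (x : ℕ) :
    |(1 + d) ^ x - 1 - x * d| ≤ (x : ℝ) * ((x : ℝ) - 1) * 2 ^ x * d ^ 2 := by
  induction x with
  | zero => simp
  | succ x ih =>
    have e : (1 + d) ^ (x + 1) - 1 - ((x + 1 : ℕ) : ℝ) * d
        = (1 + d) * ((1 + d) ^ x - 1 - x * d) + x * d ^ 2 := by push_cast; ring
    have h1 : |1 + d| ≤ 2 := (abs_add_le _ _).trans (by rw [abs_one]; linarith)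
    rw [e]
    refine (abs_add_le _ _).trans ?_
    rw [abs_mul, abs_of_nonneg (by positivity : 0 ≤ (x : ℝ) * d ^ 2)]
    have h2 : |1 + d| * |(1 + d) ^ x - 1 - x * d|
        ≤ 2 * ((x : ℝ) * ((x : ℝ) - 1) * 2 ^ x * d ^ 2) :=
      mul_le_mul h1 ih (abs_nonneg _) (by norm_num)
    have h3 : (1 : ℝ) ≤ 2 ^ x := one_le_pow₀ (by norm_num)
    have h4 : (0 : ℝ) ≤ x * d ^ 2 := by positivity
    rw [show (2 : ℝ) ^ (x + 1) = 2 * 2 ^ x by ring]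
    push_cast
    nlinarith [mul_le_mul_of_nonneg_left h3 h4]

/-- The mixture ratio deviates from `1` only to second order in `δ`. -/
lemma abs_mixtureRatio_sub_one_le {M lam δ : ℝ} (hl : 0 ≤ lam) (hM : lam ≤ M) (h0 : 0 ≤ δ)
    (h1 : δ ≤ 1) (x : ℕ) :
    |mixtureRatio lam δ x - 1| ≤ (M + 1) * Real.exp M * δ ^ 2 * envelope lam x := by
  have hw0 := natCast_mul_sub_one_nonneg x
  have h2 : (1 : ℝ) ≤ 2 ^ x := one_le_pow₀ (by norm_num)
  have hwt : (x : ℝ) * ((x : ℝ) - 1) ≤ (x : ℝ) * ((x : ℝ) - 1) * 2 ^ x :=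
    le_mul_of_one_le_right hw0 h2
  have hx : (x : ℝ) ≤ 1 + (x : ℝ) * ((x : ℝ) - 1) := by nlinarith [sq_nonneg ((x : ℝ) - 1)]
  have hp := abs_one_add_pow_sub_le (d := δ) (by rw [abs_of_nonneg h0]; exact h1) x
  have hn := abs_one_add_pow_sub_le (d := -δ) (by rw [abs_neg, abs_of_nonneg h0]; exact h1) x
  rw [neg_sq] at hn
  rw [envelope]
  set t := (x : ℝ) * ((x : ℝ) - 1) * 2 ^ x with ht
  set ρ := (1 + δ) ^ x - 1 - x * δ with hρ
  set ρ' := (1 + -δ) ^ x - 1 - x * -δ with hρ'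
  set y := lam * δ with hy
  have hy0 : 0 ≤ y := by positivity
  have hyM : y ≤ M := (mul_le_of_le_one_right hl h1).trans hM
  have hM0 : 0 ≤ M := hl.trans hM
  set E := Real.exp y with hE
  set F := Real.exp (-y) with hF
  have hEF : F * E = 1 := by rw [hE, hF, ← Real.exp_add]; simp
  have hF0 : 0 < F := Real.exp_pos _
  have hE0 : 0 < E := Real.exp_pos _
  have hEM : E ≤ Real.exp M := Real.exp_le_exp.2 hyM
  have hE1 : 1 ≤ E := Real.one_le_exp hy0
  have hF1 : F ≤ 1 := Real.exp_le_one_iff.2 (by linarith)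
  have hFy : 1 - F ≤ y := by linarith [Real.add_one_le_exp (-y)]
  have hEy : E - 1 ≤ y * E := by nlinarith
  have e : mixtureRatio lam δ x - 1
      = (E - 1) * (1 - F) / 2 - x * δ * ((E - 1) + (1 - F)) / 2 + (F * ρ + E * ρ') / 2 := by
    rw [mixtureRatio, hρ, hρ', sub_eq_add_neg 1 δ, ← hy, ← hE, ← hF]
    linear_combination (1 / 2) * hEF
  rw [e]
  have a1 : 0 ≤ (E - 1) * (1 - F) := mul_nonneg (by linarith) (by linarith)
  have a2 : (E - 1) * (1 - F) ≤ y * E * y :=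
    mul_le_mul hEy hFy (by linarith) (by positivity)
  have a3 : (E - 1) + (1 - F) ≤ 2 * (y * E) := by nlinarith
  have a4 : 0 ≤ (E - 1) + (1 - F) := by linarith
  have ht0 : 0 ≤ t := hw0.trans hwt
  have a5 : |F * ρ| ≤ E * (t * δ ^ 2) := by
    rw [abs_mul, abs_of_pos hF0]
    exact mul_le_mul (by linarith) hp (abs_nonneg _) hE0.le
  have a6 : |E * ρ'| ≤ E * (t * δ ^ 2) := by
    rw [abs_mul, abs_of_pos hE0]
    exact mul_le_mul_of_nonneg_left hn hE0.le
  have hxt : (x : ℝ) ≤ 1 + t := by linarith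
  have b1 : |(E - 1) * (1 - F) / 2| ≤ E * δ ^ 2 * (M * lam) := by
    rw [abs_of_nonneg (by positivity)]
    have : y * E * y ≤ E * δ ^ 2 * (M * lam) := by
      have : lam * lam ≤ M * lam := mul_le_mul_of_nonneg_right hM hl
      calc y * E * y = E * δ ^ 2 * (lam * lam) := by rw [hy]; ring
        _ ≤ _ := by gcongr
    linarith
  have b2 : |x * δ * ((E - 1) + (1 - F)) / 2| ≤ E * δ ^ 2 * (lam + M * t) := by
    rw [abs_of_nonneg (by positivity)]
    calc x * δ * ((E - 1) + (1 - F)) / 2 ≤ x * δ * (2 * (y * E)) / 2 := by gcongr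
      _ = E * δ ^ 2 * (lam * x) := by rw [hy]; ring
      _ ≤ E * δ ^ 2 * (lam + M * t) := by
          have : lam * x ≤ lam + M * t := by
            have c1 : lam * x ≤ lam * (1 + t) := by gcongr
            have c2 : lam * t ≤ M * t := by gcongr
            linarith
          gcongr
  have b3 : |(F * ρ + E * ρ') / 2| ≤ E * δ ^ 2 * t := by
    rw [abs_div, abs_two]
    have := abs_add_le (F * ρ) (E * ρ')
    linarith
  calc _ ≤ |(E - 1) * (1 - F) / 2| + |x * δ * ((E - 1) + (1 - F)) / 2|
        + |(F * ρ + E * ρ') / 2| := (abs_add_le _ _).trans (by gcongr; exact abs_sub _ _)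
    _ ≤ E * δ ^ 2 * (M * lam) + E * δ ^ 2 * (lam + M * t) + E * δ ^ 2 * t := by gcongr
    _ = (M + 1) * E * δ ^ 2 * (lam + t) := by ring
    _ ≤ _ := by gcongr

lemma mixtureRatio_fourth_moment {M δ : ℝ} {r : ℝ≥0} (hM : (r : ℝ) ≤ M) (h0 : 0 ≤ δ)
    (h1 : δ ≤ 1) :
    Integrable (fun x => (mixtureRatio r δ x - 1) ^ 4) (poissonMeasure r) ∧
    ∫ x, (mixtureRatio r δ x - 1) ^ 4 ∂poissonMeasure r
      ≤ ((M + 1) * Real.exp M * δ ^ 2) ^ 4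
        * (8 * (M ^ 2 + 8192 * Real.exp (2046 * M)) * (r : ℝ) ^ 2) := by
  obtain ⟨hi, hb⟩ := envelope_fourth_moment r.coe_nonneg hM (r := r)
    (by linarith [r.coe_nonneg])
  have hpt : ∀ x, (mixtureRatio r δ x - 1) ^ 4
      ≤ ((M + 1) * Real.exp M * δ ^ 2) ^ 4 * envelope r x ^ 4 := fun x => by
    rw [← mul_pow, ← abs_of_nonneg (by positivity : 0 ≤ (mixtureRatio r δ x - 1) ^ 4), abs_pow]
    exact pow_le_pow_left₀ (abs_nonneg _)
      (abs_mixtureRatio_sub_one_le r.coe_nonneg hM h0 h1 x) 4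
  have i4 : Integrable (fun x => (mixtureRatio r δ x - 1) ^ 4) (poissonMeasure r) :=
    (hi.const_mul _).mono' .of_discrete (ae_of_all _ fun x => by
      rw [Real.norm_eq_abs, abs_of_nonneg (by positivity)]; exact hpt x)
  refine ⟨i4, (integral_mono i4 (hi.const_mul _) hpt).trans ?_⟩
  rw [integral_const_mul]
  gcongr

end PoissonMoments

/-! ### Elementary properties of the risk and the Bayes lower bound -/

instance isProbabilityMeasure_dataLaw (n : ℝ) {N : ℕ} (Q : Fin N → ℝ) :
    IsProbabilityMeasure (dataLaw n Q) := by
  unfold dataLaw; infer_instance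

lemma risk_nonneg (n : ℝ) {N : ℕ} (ψ : Test N) (Q : Fin N → ℝ) : 0 ≤ risk n ψ Q :=
  add_nonneg measureReal_nonneg measureReal_nonneg

lemma risk_le_two (n : ℝ) {N : ℕ} (ψ : Test N) (Q : Fin N → ℝ) : risk n ψ Q ≤ 2 := by
  unfold risk
  linarith [measureReal_le_one (μ := dataLaw n (uniformRate N)) (s := {o | ψ o = true}),
    measureReal_le_one (μ := dataLaw n Q) (s := {o | ψ o = false})]

lemma bddAbove_risk (n : ℝ) {N : ℕ} (ψ : Test N) (V : Set (Fin N → ℝ)) :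
    BddAbove (Set.range fun Q : V => risk n ψ (Q : Fin N → ℝ)) :=
  ⟨2, by rintro _ ⟨Q, rfl⟩; exact risk_le_two _ _ _⟩

lemma iSup_risk_nonneg (n : ℝ) {N : ℕ} (ψ : Test N) (V : Set (Fin N → ℝ)) :
    0 ≤ ⨆ Q : V, risk n ψ (Q : Fin N → ℝ) :=
  Real.iSup_nonneg fun _ => risk_nonneg _ _ _

lemma bddBelow_iSup_risk (n : ℝ) {N : ℕ} (V : Set (Fin N → ℝ)) :
    BddBelow (Set.range fun ψ : Test N => ⨆ Q : V, risk n ψ (Q : Fin N → ℝ)) :=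
  ⟨0, by rintro _ ⟨ψ, rfl⟩; exact iSup_risk_nonneg _ _ _⟩

lemma minimaxRisk_nonneg (n : ℝ) {N : ℕ} (V : Set (Fin N → ℝ)) : 0 ≤ minimaxRisk n V :=
  Real.iInf_nonneg fun _ => iSup_risk_nonneg _ _ _

lemma minimaxRisk_le_iSup (n : ℝ) {N : ℕ} (V : Set (Fin N → ℝ)) (ψ : Test N) :
    minimaxRisk n V ≤ ⨆ Q : V, risk n ψ (Q : Fin N → ℝ) :=
  ciInf_le (bddBelow_iSup_risk n V) ψ

/-- Empty sets of alternatives are allowed: the risks are nonnegative and the supremum of the empty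
set of reals is zero. -/
lemma minimaxRisk_mono (n : ℝ) {N : ℕ} {V W : Set (Fin N → ℝ)} (h : V ⊆ W) :
    minimaxRisk n V ≤ minimaxRisk n W :=
  ciInf_mono (bddBelow_iSup_risk n V) fun ψ =>
    Real.iSup_le (fun Q => le_ciSup (bddAbove_risk n ψ W) ⟨Q.1, h Q.2⟩)
      (iSup_risk_nonneg n ψ W)

/-- The test that never rejects shows that the minimax risk is at most one. -/
lemma minimaxRisk_le_one (n : ℝ) {N : ℕ} (V : Set (Fin N → ℝ)) : minimaxRisk n V ≤ 1 := by
  refine (minimaxRisk_le_iSup n V fun _ => false).trans (Real.iSup_le (fun Q => ?_) zero_le_one)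
  simp [risk]

/-- The density of the Poisson law of mean `lam * (1 + d)` with respect to that of mean `lam`. -/
noncomputable def poissonRatio (lam d : ℝ) (x : ℕ) : ℝ := Real.exp (-(lam * d)) * (1 + d) ^ x

lemma poissonRatio_nonneg {lam d : ℝ} (hd : -1 ≤ d) (x : ℕ) : 0 ≤ poissonRatio lam d x := by
  have : 0 ≤ 1 + d := by linarith
  rw [poissonRatio]; positivity

lemma pi_poissonMeasure_eq_withDensity {N : ℕ} (r : NNReal) (d : Fin N → ℝ)
    (hd : ∀ i, -1 ≤ d i) (r' : Fin N → NNReal) (hr' : ∀ i, (r' i : ℝ) = r * (1 + d i)) :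
    Measure.pi (fun i => poissonMeasure (r' i))
      = (Measure.pi fun _ : Fin N => poissonMeasure r).withDensity
          (fun o => ENNReal.ofReal (∏ i, poissonRatio r (d i) (o i))) := by
  refine Measure.ext_of_singleton fun o => ?_
  rw [withDensity_apply _ (measurableSet_singleton _), lintegral_singleton, Measure.pi_singleton,
    Measure.pi_singleton,
    ENNReal.ofReal_prod_of_nonneg (fun i _ => poissonRatio_nonneg (hd i) _),
    ← Finset.prod_mul_distrib]
  refine Finset.prod_congr rfl fun i _ => ?_
  rw [poissonMeasure_singleton, poissonMeasure_singleton,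
    ← ENNReal.ofReal_mul (poissonRatio_nonneg (hd i) _)]
  congr 1
  rw [poissonRatio, hr', mul_pow,
    show -((r : ℝ) * (1 + d i)) = -(r * d i) + -r by ring, Real.exp_add]
  ring

lemma integrable_prod_poissonRatio {N : ℕ} (r : NNReal) (d : Fin N → ℝ) :
    Integrable (fun o : Fin N → ℕ => ∏ i, poissonRatio r (d i) (o i))
      (Measure.pi fun _ : Fin N => poissonMeasure r) :=
  Integrable.fintype_prod (f := fun i x => poissonRatio r (d i) x)
    fun _ => (integrable_pow_poissonMeasure r _).const_mul _

lemma measureReal_pi_poissonMeasure {N : ℕ} (r : NNReal) (d : Fin N → ℝ)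
    (hd : ∀ i, -1 ≤ d i) (r' : Fin N → NNReal) (hr' : ∀ i, (r' i : ℝ) = r * (1 + d i))
    (B : Set (Fin N → ℕ)) :
    (Measure.pi fun i => poissonMeasure (r' i)).real B
      = ∫ o in B, ∏ i, poissonRatio r (d i) (o i) ∂(Measure.pi fun _ => poissonMeasure r) := by
  have hB : MeasurableSet B := B.to_countable.measurableSet
  rw [pi_poissonMeasure_eq_withDensity r d hd r' hr', measureReal_def, withDensity_apply _ hB,
    ← ofReal_integral_eq_lintegral_ofReal (integrable_prod_poissonRatio r d).integrableOn
      (ae_of_all _ fun o => Finset.prod_nonneg fun i _ => poissonRatio_nonneg (hd i) _),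
    ENNReal.toReal_ofReal]
  exact integral_nonneg fun o => Finset.prod_nonneg fun i _ => poissonRatio_nonneg (hd i) _

/-- The signs of a two-point perturbation. -/
def signed (δ : ℝ) (b : Bool) : ℝ := if b then δ else -δ

lemma prod_mixtureRatio {N : ℕ} (lam δ : ℝ) (o : Fin N → ℕ) :
    ∏ i, mixtureRatio lam δ (o i)
      = (1 / 2 ^ N) * ∑ σ : Fin N → Bool, ∏ i, poissonRatio lam (signed δ (σ i)) (o i) := by
  have h : ∀ x, mixtureRatio lam δ x = (1 / 2) * ∑ b : Bool, poissonRatio lam (signed δ b) x := by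
    intro x
    simp only [Fintype.sum_bool, signed, poissonRatio, mixtureRatio]
    simp
    ring
  simp_rw [h]
  rw [Finset.prod_mul_distrib, Fintype.prod_sum]
  simp

/-- The perturbed rate vector `((1 ± δ) / N)` with signs `σ`. -/
noncomputable def signedRate (N : ℕ) (δ : ℝ) (σ : Fin N → Bool) : Fin N → ℝ :=
  fun i => (1 + signed δ (σ i)) / N

/-- The Bayes lower bound: the uniform prior over the sign vectors of a two-point perturbation. -/
lemma integral_min_one_prod_mixtureRatio_le_minimaxRisk {n δ : ℝ} {N : ℕ} {V : Set (Fin N → ℝ)}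
    (hn : 0 ≤ n) (h0 : 0 ≤ δ) (h1 : δ ≤ 1) (hV : ∀ σ, signedRate N δ σ ∈ V)
    {r : NNReal} (hr : (r : ℝ) = n / N) :
    ∫ o, min 1 (∏ i, mixtureRatio r δ (o i)) ∂(Measure.pi fun _ : Fin N => poissonMeasure r)
      ≤ minimaxRisk n V := by
  refine le_ciInf fun ψ => ?_
  set P := Measure.pi fun _ : Fin N => poissonMeasure r with hP
  have hsg : ∀ b, -1 ≤ signed δ b := fun b => by cases b <;> simp [signed] <;> linarith
  have hnull : dataLaw n (uniformRate N) = P := by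
    rw [dataLaw, hP]
    congr 1; ext i : 1; congr 1
    ext
    rw [Real.coe_toNNReal _ (by unfold uniformRate; positivity), hr, uniformRate]
    ring
  have halt : ∀ σ, (dataLaw n (signedRate N δ σ)).real {o | ψ o = false}
      = ∫ o in {o | ψ o = false}, ∏ i, poissonRatio r (signed δ (σ i)) (o i) ∂P := by
    intro σ
    refine measureReal_pi_poissonMeasure r (fun i => signed δ (σ i)) (fun i => hsg _) _
      (fun i => ?_) _
    have : 0 ≤ 1 + signed δ (σ i) := by linarith [hsg (σ i)]
    rw [Real.coe_toNNReal _ (by unfold signedRate; positivity), hr, signedRate]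
    ring
  have hsup : ∀ σ, risk n ψ (signedRate N δ σ) ≤ ⨆ Q : V, risk n ψ (Q : Fin N → ℝ) := fun σ =>
    le_ciSup (bddAbove_risk n ψ V) ⟨_, hV σ⟩
  set S := ⨆ Q : V, risk n ψ (Q : Fin N → ℝ)
  have hLi : Integrable (fun o : Fin N → ℕ => ∏ i, mixtureRatio r δ (o i)) P :=
    Integrable.fintype_prod (f := fun _ x => mixtureRatio r δ x)
      fun _ => integrable_mixtureRatio r r δ
  have hmi : Integrable (fun o : Fin N → ℕ => min 1 (∏ i, mixtureRatio r δ (o i))) P :=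
    (integrable_const 1).inf hLi
  have hB : MeasurableSet {o : Fin N → ℕ | ψ o = false} := (Set.to_countable _).measurableSet
  have hcompl : {o : Fin N → ℕ | ψ o = false}ᶜ = {o | ψ o = true} := by ext o; simp
  have hmean : ∫ o in {o | ψ o = false}, ∏ i, mixtureRatio r δ (o i) ∂P
      = (1 / 2 ^ N) * ∑ σ, (dataLaw n (signedRate N δ σ)).real {o | ψ o = false} := by
    simp_rw [prod_mixtureRatio, halt]
    rw [integral_const_mul, integral_finsetSum _ fun σ _ =>
      (integrable_prod_poissonRatio r _).integrableOn]
  calc ∫ o, min 1 (∏ i, mixtureRatio r δ (o i)) ∂P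
      = (∫ o in {o | ψ o = false}, min 1 (∏ i, mixtureRatio r δ (o i)) ∂P)
        + ∫ o in {o | ψ o = true}, min 1 (∏ i, mixtureRatio r δ (o i)) ∂P := by
        rw [← hcompl, integral_add_compl hB hmi]
    _ ≤ (∫ o in {o | ψ o = false}, ∏ i, mixtureRatio r δ (o i) ∂P)
        + ∫ o in {o | ψ o = true}, (1 : ℝ) ∂P := by
        refine add_le_add ?_ ?_
        · exact integral_mono hmi.integrableOn hLi.integrableOn fun o => min_le_right _ _
        · exact integral_mono hmi.integrableOn (integrable_const _) fun o => min_le_left _ _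
    _ = (1 / 2 ^ N) * ∑ σ, risk n ψ (signedRate N δ σ) := by
        rw [hmean]
        simp only [risk, hnull, Finset.sum_add_distrib]
        have h2 : (2 : ℝ) ^ N ≠ 0 := by positivity
        simp
        field_simp
        ring
    _ ≤ (1 / 2 ^ N) * ∑ _σ : Fin N → Bool, S := by gcongr with σ; exact hsup σ
    _ = S := by simp

/-! ### The least favourable perturbation -/

/-- The relative size `δ = ε N^{1 - 1/p}` of the least favourable perturbation, for which
`((1 ± δ) / N)` lies on the boundary of the `ℓ_p` ball of radius `ε`. -/
noncomputable def relPert (p ε : ℝ) (N : ℕ) : ℝ := ε * (N : ℝ) ^ (1 - 1 / p)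

lemma relPert_sq {p ε : ℝ} {N : ℕ} (hN : 0 < N) :
    relPert p ε N ^ 2 = ε ^ 2 * (N : ℝ) ^ (2 - 2 / p) := by
  have hN' : (0 : ℝ) < N := Nat.cast_pos.2 hN
  rw [relPert, mul_pow, ← Real.rpow_natCast ((N : ℝ) ^ (1 - 1 / p)), ← Real.rpow_mul hN'.le]
  congr 2
  push_cast; ring

lemma uStar_eq {p ε n : ℝ} {N : ℕ} (hN : 0 < N) :
    uStar p ε n N = relPert p ε N ^ 2 * n / √(2 * N) := by
  rw [uStar, relPert_sq hN]; ring

lemma uStar_sq {p ε n : ℝ} {N : ℕ} (hN : 0 < N) :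
    uStar p ε n N ^ 2 = N * (n / N * relPert p ε N ^ 2) ^ 2 / 2 := by
  have hN' : (0 : ℝ) < N := Nat.cast_pos.2 hN
  rw [uStar_eq hN, div_pow, Real.sq_sqrt (by positivity)]
  field_simp

lemma relPert_nonneg {p ε : ℝ} (hε : 0 ≤ ε) (N : ℕ) : 0 ≤ relPert p ε N := by
  unfold relPert; positivity

lemma relPert_le {p ε ξ : ℝ} {N : ℕ} (hN : 0 < N) (h : ε ≤ ξ * (N : ℝ) ^ (-1 + 1 / p)) :
    relPert p ε N ≤ ξ := by
  have hN' : (0 : ℝ) < N := Nat.cast_pos.2 hN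
  calc relPert p ε N ≤ ξ * (N : ℝ) ^ (-1 + 1 / p) * (N : ℝ) ^ (1 - 1 / p) := by
        unfold relPert; gcongr
    _ = ξ := by
        rw [mul_assoc, ← Real.rpow_add hN', show -1 + 1 / p + (1 - 1 / p) = 0 by ring,
          Real.rpow_zero, mul_one]

lemma signedRate_mem_altSetCube {p ε ξ : ℝ} {N : ℕ} (hp : 0 < p) (hN : 0 < N) (hε : 0 ≤ ε)
    (h : ε ≤ ξ * (N : ℝ) ^ (-1 + 1 / p)) (h1 : relPert p ε N ≤ 1) (σ : Fin N → Bool) :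
    signedRate N (relPert p ε N) σ ∈ altSetCube N p ε ξ := by
  have hN' : (0 : ℝ) < N := Nat.cast_pos.2 hN
  have hd := relPert_nonneg (p := p) hε N
  have habs : ∀ i, |signedRate N (relPert p ε N) σ i - 1 / N| = relPert p ε N / N := by
    intro i
    have e : signedRate N (relPert p ε N) σ i - 1 / N = signed (relPert p ε N) (σ i) / N := by
      rw [signedRate]; ring
    rw [e, abs_div, Nat.abs_cast]
    congr 1
    cases σ i <;> simp [signed, abs_of_nonneg hd]
  have hpos : ∀ i, 0 ≤ signedRate N (relPert p ε N) σ i := by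
    intro i
    rw [signedRate]
    refine div_nonneg ?_ hN'.le
    cases σ i <;> simp [signed] <;> linarith
  refine ⟨⟨hpos, ?_⟩, hpos, fun i => ?_⟩
  · simp_rw [habs]
    have e : relPert p ε N / N = ε * (N : ℝ) ^ (-(1 / p)) := by
      rw [relPert, mul_div_assoc]
      nth_rewrite 2 [← Real.rpow_one (N : ℝ)]
      rw [← Real.rpow_sub hN']
      congr 2; ring
    rw [e, Real.mul_rpow hε (by positivity), ← Real.rpow_mul hN'.le,
      show -(1 / p) * p = -1 by field_simp, Real.rpow_neg_one]
    simp only [Finset.sum_const, Finset.card_univ, Fintype.card_fin, nsmul_eq_mul]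
    apply le_of_eq
    field_simp
  · rw [habs]
    exact div_le_div_of_nonneg_right (relPert_le hN h) hN'.le

/-- The power mean inequality: within the complement of an `ℓ_p` ball, `p ≤ 2`, the quadratic
deviation is at least that of the perturbation with equal coordinates. -/
lemma sq_mul_rpow_le_sum_sq {p ε : ℝ} {N : ℕ} (hp0 : 0 < p) (hp2 : p ≤ 2) (hN : 0 < N)
    (hε : 0 ≤ ε) (a : Fin N → ℝ) (h : ε ^ p ≤ ∑ i, |a i| ^ p) :
    ε ^ 2 * (N : ℝ) ^ (1 - 2 / p) ≤ ∑ i, a i ^ 2 := by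
  have hN' : (0 : ℝ) < N := Nat.cast_pos.2 hN
  have hq : 1 ≤ 2 / p := by rwa [le_div_iff₀ hp0, one_mul]
  have h1 := Real.rpow_sum_le_const_mul_sum_rpow_of_nonneg (s := Finset.univ)
    (f := fun i => |a i| ^ p) hq (fun i _ => by positivity)
  have h2 : ∀ i, (|a i| ^ p) ^ (2 / p) = a i ^ 2 := fun i => by
    rw [← Real.rpow_mul (abs_nonneg _), show p * (2 / p) = ((2 : ℕ) : ℝ) by
      push_cast; field_simp, Real.rpow_natCast, sq_abs]
  have h3 : (ε ^ p) ^ (2 / p) = ε ^ 2 := by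
    rw [← Real.rpow_mul hε, show p * (2 / p) = ((2 : ℕ) : ℝ) by push_cast; field_simp,
      Real.rpow_natCast]
  simp_rw [h2] at h1
  have h4 : ε ^ 2 ≤ (N : ℝ) ^ (2 / p - 1) * ∑ i, a i ^ 2 := by
    rw [← h3]
    refine (Real.rpow_le_rpow (by positivity) h (by positivity)).trans ?_
    simpa using h1
  calc ε ^ 2 * (N : ℝ) ^ (1 - 2 / p)
      ≤ ((N : ℝ) ^ (2 / p - 1) * ∑ i, a i ^ 2) * (N : ℝ) ^ (1 - 2 / p) := by gcongr
    _ = ∑ i, a i ^ 2 := by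
        rw [mul_right_comm, ← Real.rpow_add hN', show 2 / p - 1 + (1 - 2 / p) = 0 by ring,
          Real.rpow_zero, one_mul]

lemma sq_div_two_le_cosh_sub_one (y : ℝ) : y ^ 2 / 2 ≤ Real.cosh y - 1 := by
  have h1 : (y / 2) ^ 2 ≤ Real.sinh (y / 2) ^ 2 := by
    rw [sq_le_sq, Real.abs_sinh]
    exact Real.self_le_sinh_iff.2 (abs_nonneg _)
  have h2 := Real.cosh_two_mul (y / 2)
  rw [mul_div_cancel₀ y two_ne_zero, Real.cosh_sq] at h2
  linarith

lemma cosh_sub_one_le {y : ℝ} (hy : |y| ≤ 1) : Real.cosh y - 1 ≤ y ^ 2 / 2 + y ^ 4 / 4 := by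
  have h1 := Real.cosh_le_exp_half_sq y
  have hy2 : y ^ 2 ≤ 1 := (sq_le_one_iff_abs_le_one y).2 hy
  have h2 := (abs_le.1 (Real.abs_exp_sub_one_sub_id_le (x := y ^ 2 / 2)
    (by rw [abs_of_nonneg (by positivity)]; linarith))).2
  nlinarith

/-- The asymptotic regime: `n`, `N → ∞` with `n / N` bounded, and alternatives of size `ε` in
a shrinking relative neighbourhood of size `ξ` of the uniform rate. -/
structure IsRegime (p M : ℝ) (n : ℕ → ℝ) (N : ℕ → ℕ) (ε ξ : ℕ → ℝ) : Prop where
  p_pos : 0 < p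
  p_le_two : p ≤ 2
  tendsto_n : Tendsto n atTop atTop
  tendsto_N : Tendsto N atTop atTop
  ratio_le : ∀ k, n k / (N k : ℝ) ≤ M
  eps_pos : ∀ k, 0 < ε k
  tendsto_xi : Tendsto ξ atTop (𝓝 0)
  eps_le : ∀ k, ε k ≤ ξ k * (N k : ℝ) ^ (-1 + 1 / p)

namespace IsRegime

variable {p M : ℝ} {n : ℕ → ℝ} {N : ℕ → ℕ} {ε ξ : ℕ → ℝ}

lemma comp (h : IsRegime p M n N ε ξ) {φ : ℕ → ℕ} (hφ : Tendsto φ atTop atTop) :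
    IsRegime p M (n ∘ φ) (N ∘ φ) (ε ∘ φ) (ξ ∘ φ) where
  p_pos := h.p_pos
  p_le_two := h.p_le_two
  tendsto_n := h.tendsto_n.comp hφ
  tendsto_N := h.tendsto_N.comp hφ
  ratio_le k := h.ratio_le (φ k)
  eps_pos k := h.eps_pos (φ k)
  tendsto_xi := h.tendsto_xi.comp hφ
  eps_le k := h.eps_le (φ k)

lemma eventually_pos (h : IsRegime p M n N ε ξ) : ∀ᶠ k in atTop, 0 < n k ∧ 0 < N k ∧ ξ k ≤ 1 := by
  filter_upwards [h.tendsto_n.eventually_gt_atTop 0, h.tendsto_N.eventually_gt_atTop 0,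
    h.tendsto_xi.eventually_le_const zero_lt_one] with k h1 h2 h3
  exact ⟨h1, h2, h3⟩

lemma tendsto_relPert (h : IsRegime p M n N ε ξ) :
    Tendsto (fun k => relPert p (ε k) (N k)) atTop (𝓝 0) := by
  refine squeeze_zero' (Eventually.of_forall fun k => relPert_nonneg (h.eps_pos k).le _) ?_
    h.tendsto_xi
  filter_upwards [h.eventually_pos] with k hk
  exact relPert_le hk.2.1 (h.eps_le k)

/-! ### The minimax lower bound -/

/-- The centred mixture ratios form a Lyapunov array with total variance
`N (cosh (n δ ^ 2 / N) - 1) ≈ (u*) ^ 2` and total fourth moment of order `(u*) ^ 2 δ ^ 4`. -/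
lemma isLyapunovArray_mixtureRatio (h : IsRegime p M n N ε ξ) {c : ℝ}
    (hu : Tendsto (fun k => uStar p (ε k) (n k) (N k)) atTop (𝓝 c)) :
    IsLyapunovArray (N := N) (fun k _ => poissonMeasure (n k / N k).toNNReal)
      (fun k _ x => mixtureRatio ((n k / N k).toNNReal : ℝ) (relPert p (ε k) (N k)) x - 1)
      (c ^ 2) := by
  have hδ := h.tendsto_relPert
  have hδ2 : Tendsto (fun k => relPert p (ε k) (N k) ^ 2) atTop (𝓝 0) := by
    simpa using hδ.pow 2
  have hev : ∀ᶠ k in atTop, 0 < N k ∧ ((n k / N k).toNNReal : ℝ) = n k / N k ∧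
      0 ≤ n k / N k ∧ relPert p (ε k) (N k) ≤ 1 := by
    filter_upwards [h.eventually_pos] with k hk
    have : 0 ≤ n k / N k := div_nonneg hk.1.le (Nat.cast_nonneg _)
    exact ⟨hk.2.1, Real.coe_toNNReal _ this, this, (relPert_le hk.2.1 (h.eps_le k)).trans hk.2.2⟩
  have hy : Tendsto (fun k => n k / N k * relPert p (ε k) (N k) ^ 2) atTop (𝓝 0) := by
    refine squeeze_zero' (g := fun k => M * relPert p (ε k) (N k) ^ 2) ?_ ?_
      (by simpa using hδ2.const_mul M)
    · filter_upwards [hev] with k hk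
      exact mul_nonneg hk.2.2.1 (sq_nonneg _)
    · exact Eventually.of_forall fun k =>
        mul_le_mul_of_nonneg_right (h.ratio_le k) (sq_nonneg _)
  refine ⟨fun _ _ => .of_discrete, ?_, ?_, ?_, ?_⟩
  · filter_upwards [hev] with k hk i
    exact (mixtureRatio_fourth_moment (M := M) (by rw [hk.2.1]; exact h.ratio_le k)
      (relPert_nonneg (h.eps_pos k).le _) hk.2.2.2).1
  · refine Eventually.of_forall fun k i => ?_
    rw [integral_sub (integrable_mixtureRatio _ _ _) (integrable_const _), integral_mixtureRatio]
    simp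
  · simp only [integral_mixtureRatio_sub_one_sq, Finset.sum_const, Finset.card_univ,
      Fintype.card_fin, nsmul_eq_mul]
    have hup : Tendsto (fun k => uStar p (ε k) (n k) (N k) ^ 2
        + uStar p (ε k) (n k) (N k) ^ 2 * (n k / N k * relPert p (ε k) (N k) ^ 2) ^ 2 / 2)
        atTop (𝓝 (c ^ 2)) := by
      have := (hu.pow 2).add (((hu.pow 2).mul (hy.pow 2)).div_const 2)
      simpa using this
    refine tendsto_of_tendsto_of_tendsto_of_le_of_le' (hu.pow 2) hup ?_ ?_
    · filter_upwards [hev] with k hk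
      rw [hk.2.1, uStar_sq hk.1]
      have := mul_le_mul_of_nonneg_left (sq_div_two_le_cosh_sub_one
        (n k / N k * relPert p (ε k) (N k) ^ 2)) (Nat.cast_nonneg (α := ℝ) (N k))
      linarith
    · filter_upwards [hev, hy.abs.eventually_le_const (u := 1) (by simp)] with k hk hk1
      rw [hk.2.1, uStar_sq hk.1]
      have := mul_le_mul_of_nonneg_left (cosh_sub_one_le hk1) (Nat.cast_nonneg (α := ℝ) (N k))
      refine this.trans (le_of_eq ?_)
      ring
  · have hlim : Tendsto (fun k => ((M + 1) * Real.exp M) ^ 4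
        * (8 * (M ^ 2 + 8192 * Real.exp (2046 * M))) * 2
        * (uStar p (ε k) (n k) (N k) ^ 2 * (relPert p (ε k) (N k) ^ 2) ^ 2)) atTop (𝓝 0) := by
      have := (((hu.pow 2).mul (hδ2.pow 2)).const_mul (((M + 1) * Real.exp M) ^ 4
        * (8 * (M ^ 2 + 8192 * Real.exp (2046 * M))) * 2))
      simpa using this
    refine squeeze_zero' (Eventually.of_forall fun k => Finset.sum_nonneg fun i _ =>
      integral_nonneg fun x => by positivity) ?_ hlim
    filter_upwards [hev] with k hk
    simp only [Finset.sum_const, Finset.card_univ, Fintype.card_fin, nsmul_eq_mul]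
    have hb := (mixtureRatio_fourth_moment (M := M) (r := (n k / N k).toNNReal)
      (by rw [hk.2.1]; exact h.ratio_le k) (relPert_nonneg (h.eps_pos k).le _) hk.2.2.2).2
    refine (mul_le_mul_of_nonneg_left hb (Nat.cast_nonneg _)).trans (le_of_eq ?_)
    rw [uStar_sq hk.1, hk.2.1]
    ring

/-- The Bayes risk of the two-point prior has the Gaussian limit and bounds the minimax risk. -/
lemma exists_lower_bound (h : IsRegime p M n N ε ξ) {c : ℝ} (hc : 0 ≤ c)
    (hu : Tendsto (fun k => uStar p (ε k) (n k) (N k)) atTop (𝓝 c)) :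
    ∃ B : ℕ → ℝ, Tendsto B atTop (𝓝 (2 * stdNormalCDF (-c / 2))) ∧
      ∀ᶠ k in atTop, B k ≤ minimaxRisk (n k) (altSetCube (N k) p (ε k) (ξ k)) := by
  have hδ : ∀ᶠ k in atTop, 0 < N k ∧ 0 ≤ n k ∧ relPert p (ε k) (N k) ≤ 1 := by
    filter_upwards [h.eventually_pos] with k hk
    exact ⟨hk.2.1, hk.1.le, (relPert_le hk.2.1 (h.eps_le k)).trans hk.2.2⟩
  have hlim := (h.isLyapunovArray_mixtureRatio hu).tendsto_integral_min_one_prod (by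
    filter_upwards [hδ] with k hk i x
    have := mixtureRatio_nonneg (lam := ((n k / N k).toNNReal : ℝ))
      (relPert_nonneg (p := p) (h.eps_pos k).le (N k)) hk.2.2 x
    linarith)
  rw [Real.sqrt_sq hc] at hlim
  refine ⟨_, hlim, ?_⟩
  filter_upwards [hδ] with k hk
  simp only [add_sub_cancel]
  exact integral_min_one_prod_mixtureRatio_le_minimaxRisk hk.2.1
    (relPert_nonneg (h.eps_pos k).le _) hk.2.2
    (signedRate_mem_altSetCube h.p_pos hk.1 (h.eps_pos k).le (h.eps_le k) hk.2.2)
    (Real.coe_toNNReal _ (div_nonneg hk.2.1 (Nat.cast_nonneg _)))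

end IsRegime

/-! ### The quadratic test and the upper bound -/

open Classical in
/-- The test rejecting when `∑ i, ((o i - n / N)^2 - o i)`, normalized to have variance one under
the null hypothesis, exceeds the threshold `t`. -/
noncomputable def quadTest (n : ℝ) (N : ℕ) (t : ℝ) : Test N := fun o =>
  decide (t < (∑ i, (((o i : ℝ) - n / N) ^ 2 - o i)) / (n / N * √(2 * N)))

/-- The summands of the normalized quadratic statistic, centred under the rate vector `Q`. -/
noncomputable def quadSummand (n : ℝ) {N : ℕ} (Q : Fin N → ℝ) (i : Fin N) (x : ℕ) : ℝ :=
  quadStat (n / N) (n * Q i).toNNReal x / (n / N * √(2 * N))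

lemma quadTest_eq_false_iff {n : ℝ} {N : ℕ} (t : ℝ) (Q : Fin N → ℝ) (o : Fin N → ℕ) :
    quadTest n N t o = false ↔
      (∑ i, (((n * Q i).toNNReal : ℝ) - n / N) ^ 2) / (n / N * √(2 * N)) - t
        + ∑ i, quadSummand n Q i (o i) ≤ 0 := by
  have e : ∑ i, quadSummand n Q i (o i)
      = (∑ i, (((o i : ℝ) - n / N) ^ 2 - o i)) / (n / N * √(2 * N))
        - (∑ i, (((n * Q i).toNNReal : ℝ) - n / N) ^ 2) / (n / N * √(2 * N)) := by
    simp only [quadSummand, quadStat]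
    rw [← Finset.sum_div, ← sub_div, ← Finset.sum_sub_distrib]
  rw [quadTest, decide_eq_false_iff_not, not_lt, e]
  constructor <;> intro h <;> linarith

/-- On the alternatives the mean of the normalized quadratic statistic is at least `u*`. -/
lemma uStar_le_mean {p ε n : ℝ} {N : ℕ} (hp0 : 0 < p) (hp2 : p ≤ 2) (hN : 0 < N) (hn : 0 < n)
    (hε : 0 ≤ ε) {Q : Fin N → ℝ} (hQ : Q ∈ altSet N p ε) :
    uStar p ε n N ≤ (∑ i, (((n * Q i).toNNReal : ℝ) - n / N) ^ 2) / (n / N * √(2 * N)) := by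
  have hN' : (0 : ℝ) < N := Nat.cast_pos.2 hN
  have h := sq_mul_rpow_le_sum_sq hp0 hp2 hN hε _ hQ.2
  have e : ∑ i, (((n * Q i).toNNReal : ℝ) - n / N) ^ 2 = n ^ 2 * ∑ i, (Q i - 1 / N) ^ 2 := by
    rw [Finset.mul_sum]
    refine Finset.sum_congr rfl fun i _ => ?_
    rw [Real.coe_toNNReal _ (mul_nonneg hn.le (hQ.1 i))]
    ring
  have hs : 0 < √(2 * (N : ℝ)) := Real.sqrt_pos.2 (by positivity)
  have hpow : (N : ℝ) ^ (2 - 2 / p) = N * (N : ℝ) ^ (1 - 2 / p) := by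
    rw [show 2 - 2 / p = 1 + (1 - 2 / p) by ring, Real.rpow_add hN', Real.rpow_one]
  have e2 : uStar p ε n N
      = n ^ 2 * (ε ^ 2 * (N : ℝ) ^ (1 - 2 / p)) / (n / N * √(2 * N)) := by
    rw [uStar, hpow]; field_simp
  rw [e, e2]
  gcongr

namespace IsRegime

variable {p M : ℝ} {n : ℕ → ℝ} {N : ℕ → ℕ} {ε ξ : ℕ → ℝ}

/-- When `u*` has a positive limit, `n ^ 2 / N → ∞`: otherwise `δ → 0` would force `u* → 0`. This is
what the Lyapunov condition for the quadratic statistic needs. -/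
lemma tendsto_one_div_mul_ratio_sq (h : IsRegime p M n N ε ξ) {c : ℝ} (hc : 0 < c)
    (hu : Tendsto (fun k => uStar p (ε k) (n k) (N k)) atTop (𝓝 c)) :
    Tendsto (fun k => 1 / (N k * (n k / N k) ^ 2)) atTop (𝓝 0) := by
  have h1 : Tendsto (fun k => relPert p (ε k) (N k) ^ 4 / (2 * uStar p (ε k) (n k) (N k) ^ 2))
      atTop (𝓝 0) := by
    have : Tendsto (fun k => relPert p (ε k) (N k) ^ 4 / (2 * uStar p (ε k) (n k) (N k) ^ 2))
        atTop (𝓝 (0 ^ 4 / (2 * c ^ 2))) :=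
      (h.tendsto_relPert.pow 4).div ((hu.pow 2).const_mul 2) (by positivity)
    simpa using this
  refine h1.congr' ?_
  filter_upwards [h.eventually_pos] with k hk
  have hN' : (0 : ℝ) < N k := Nat.cast_pos.2 hk.2.1
  have hδ : 0 < relPert p (ε k) (N k) := mul_pos (h.eps_pos k) (by positivity)
  have hn := hk.1
  rw [uStar_sq hk.2.1]
  field_simp

/-- The centred quadratic summands form a normalized Lyapunov array along every sequence of rate
vectors in the hypercubes, the null one included. -/
lemma isLyapunovArray_quadSummand (h : IsRegime p M n N ε ξ) {c : ℝ} (hc : 0 < c)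
    (hu : Tendsto (fun k => uStar p (ε k) (n k) (N k)) atTop (𝓝 c))
    {Q : ∀ k, Fin (N k) → ℝ} (hQ : ∀ᶠ k in atTop, ∀ i, |Q k i - 1 / N k| ≤ ξ k / N k) :
    IsLyapunovArray (fun k i => poissonMeasure (n k * Q k i).toNNReal)
      (fun k i => quadSummand (n k) (Q k) i) 1 := by
  have hev : ∀ᶠ k in atTop, 0 < n k ∧ (0 : ℝ) < N k ∧ 0 < n k / N k ∧ ξ k ≤ 1 ∧
      ∀ i, ∃ d, |d| ≤ ξ k ∧ ((n k * Q k i).toNNReal : ℝ) = n k / N k * (1 + d) := by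
    filter_upwards [h.eventually_pos, hQ] with k hk hQk
    have hN' : (0 : ℝ) < N k := Nat.cast_pos.2 hk.2.1
    refine ⟨hk.1, hN', div_pos hk.1 hN', hk.2.2, fun i => ⟨N k * Q k i - 1, ?_, ?_⟩⟩
    · have e : N k * Q k i - 1 = N k * (Q k i - 1 / N k) := by field_simp
      rw [e, abs_mul, Nat.abs_cast]
      have := mul_le_mul_of_nonneg_left (hQk i) hN'.le
      rwa [mul_div_cancel₀ _ hN'.ne'] at this
    · have hq : 0 ≤ Q k i := by
        have h1 := (abs_le.1 (hQk i)).1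
        have h2 : ξ k / N k ≤ 1 / N k := div_le_div_of_nonneg_right hk.2.2 hN'.le
        linarith
      rw [Real.coe_toNNReal _ (mul_nonneg hk.1.le hq)]
      field_simp
      ring
  have hdev : ∀ᶠ k in atTop, ∀ i, |((n k * Q k i).toNNReal : ℝ) - n k / N k| ≤ n k / N k := by
    filter_upwards [hev] with k hk i
    obtain ⟨d, hd, hr⟩ := hk.2.2.2.2 i
    rw [hr, show n k / N k * (1 + d) - n k / N k = n k / N k * d by ring, abs_mul,
      abs_of_pos hk.2.2.1]
    exact mul_le_of_le_one_right hk.2.2.1.le (hd.trans hk.2.2.2.1)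
  have hmoment := fun k (hk : ∀ i, |((n k * Q k i).toNNReal : ℝ) - n k / N k| ≤ n k / N k) i
    (hl : 0 ≤ n k / N k) => quadStat_fourth_moment hl (h.ratio_le k) (hk i)
  refine ⟨fun _ _ => .of_discrete, ?_, ?_, ?_, ?_⟩
  · filter_upwards [hev, hdev] with k hk hk' i
    simp only [quadSummand, div_pow]
    exact (hmoment k hk' i hk.2.2.1.le).1.div_const _
  · refine Eventually.of_forall fun k i => ?_
    simp only [quadSummand]
    rw [integral_div, integral_quadStat, zero_div]
  · have hξ := h.tendsto_xi
    have hz : Tendsto (fun k => 2 * ξ k + ξ k ^ 2 + 4 * M * ξ k ^ 2) atTop (𝓝 0) := by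
      have := ((hξ.const_mul 2).add (hξ.pow 2)).add ((hξ.pow 2).const_mul (4 * M))
      simpa using this
    rw [tendsto_iff_dist_tendsto_zero]
    refine squeeze_zero' (Eventually.of_forall fun _ => dist_nonneg) ?_ hz
    filter_upwards [hev] with k hk
    obtain ⟨hn, hN', hl, hξ1, hdev'⟩ := hk
    have hterm : ∀ i, |(∫ x, quadSummand (n k) (Q k) i x ^ 2 ∂poissonMeasure (n k * Q k i).toNNReal)
        - 1 / N k| ≤ (2 * ξ k + ξ k ^ 2 + 4 * M * ξ k ^ 2) / N k := by
      intro i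
      obtain ⟨d, hd, hr⟩ := hdev' i
      clear hdev'
      simp only [quadSummand, div_pow]
      rw [integral_div, integral_quadStat_sq, hr, mul_pow (n k / N k) (√(2 * N k)),
        Real.sq_sqrt (by positivity)]
      set lam := n k / N k
      have hlM : lam ≤ M := h.ratio_le k
      have hM0 : 0 ≤ M := hl.le.trans hlM
      have e : (2 * (lam * (1 + d)) ^ 2 + 4 * (lam * (1 + d) - lam) ^ 2 * (lam * (1 + d)))
          / (lam ^ 2 * (2 * N k)) - 1 / N k
          = (2 * d + d ^ 2 + 2 * lam * (1 + d) * d ^ 2) / N k := by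
        field_simp; ring
      rw [e, abs_div, Nat.abs_cast]
      refine div_le_div_of_nonneg_right ?_ hN'.le
      have h1 : |d| ≤ 1 := hd.trans hξ1
      have h2 : d ^ 2 ≤ ξ k ^ 2 := by rw [← sq_abs]; gcongr
      have h3 : 0 ≤ 1 + d := by linarith [(abs_le.1 h1).1]
      have h4 : 1 + d ≤ 2 := by linarith [(abs_le.1 h1).2]
      have h5 : 2 * lam * (1 + d) * d ^ 2 ≤ 4 * M * ξ k ^ 2 := by
        calc 2 * lam * (1 + d) * d ^ 2 ≤ 2 * M * 2 * ξ k ^ 2 := by gcongr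
          _ = _ := by ring
      refine (abs_add_le _ _).trans (add_le_add ((abs_add_le _ _).trans (add_le_add ?_ ?_)) ?_)
      · rw [abs_mul, abs_two]; linarith
      · rwa [abs_of_nonneg (sq_nonneg d)]
      · rwa [abs_of_nonneg (by positivity)]
    have e1 : (1 : ℝ) = ∑ _i : Fin (N k), 1 / (N k : ℝ) := by
      simp only [Finset.sum_const, Finset.card_univ, Fintype.card_fin, nsmul_eq_mul]
      field_simp
    rw [Real.dist_eq]
    rw [e1, ← Finset.sum_sub_distrib]
    refine (Finset.abs_sum_le_sum_abs _ _).trans ((Finset.sum_le_sum fun i _ => hterm i).trans ?_)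
    simp only [Finset.sum_const, Finset.card_univ, Fintype.card_fin, nsmul_eq_mul]
    rw [mul_div_cancel₀ _ hN'.ne']
  · set C := (2 * M + 2) ^ 4 * (8 * (M ^ 2 + 8192 * Real.exp (2046 * M))) with hC
    have hlim : Tendsto (fun k => C / 4 * (1 / (N k * (n k / N k) ^ 2))) atTop (𝓝 0) := by
      simpa using (h.tendsto_one_div_mul_ratio_sq hc hu).const_mul (C / 4)
    refine squeeze_zero' (Eventually.of_forall fun k => Finset.sum_nonneg fun i _ =>
      integral_nonneg fun x => by positivity) ?_ hlim
    filter_upwards [hev, hdev] with k hk hk'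
    obtain ⟨hn, hN', hl, -, -⟩ := hk
    have hterm : ∀ i, ∫ x, quadSummand (n k) (Q k) i x ^ 4 ∂poissonMeasure (n k * Q k i).toNNReal
        ≤ C * (n k / N k) ^ 2 / ((n k / N k) ^ 4 * (2 * N k) ^ 2) := by
      intro i
      simp only [quadSummand, div_pow _ (n k / N k * √(2 * N k))]
      rw [integral_div, mul_pow, show √(2 * (N k : ℝ)) ^ 4 = (√(2 * (N k : ℝ)) ^ 2) ^ 2 by ring,
        Real.sq_sqrt (by positivity)]
      refine div_le_div_of_nonneg_right ?_ (by positivity)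
      refine (hmoment k hk' i hl.le).2.trans (le_of_eq ?_)
      rw [hC]; ring
    refine (Finset.sum_le_sum fun i _ => hterm i).trans (le_of_eq ?_)
    simp only [Finset.sum_const, Finset.card_univ, Fintype.card_fin, nsmul_eq_mul]
    field_simp
    ring

/-- Along any sequence of alternatives, the risk of the quadratic test with threshold `u* / 2` is
bounded by a sequence with the Gaussian limit. -/
lemma exists_risk_quadTest_le (h : IsRegime p M n N ε ξ) {c : ℝ} (hc : 0 < c)
    (hu : Tendsto (fun k => uStar p (ε k) (n k) (N k)) atTop (𝓝 c))
    {Q : ∀ k, Fin (N k) → ℝ}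
    (hQ : ∀ᶠ k in atTop, Q k ∈ altSetCube (N k) p (ε k) (ξ k)) :
    ∃ A : ℕ → ℝ, Tendsto A atTop (𝓝 (2 * stdNormalCDF (-c / 2))) ∧ ∀ᶠ k in atTop,
      risk (n k) (quadTest (n k) (N k) (uStar p (ε k) (n k) (N k) / 2)) (Q k) ≤ A k := by
  have h0 := (h.isLyapunovArray_quadSummand hc hu (Q := fun k => uniformRate (N k)) (by
    filter_upwards [h.eventually_pos] with k hk i
    have hN' : (0 : ℝ) < N k := Nat.cast_pos.2 hk.2.1
    have hξ : 0 ≤ ξ k := (relPert_nonneg (h.eps_pos k).le _).trans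
      (relPert_le (p := p) hk.2.1 (h.eps_le k))
    simp only [uniformRate, sub_self, abs_zero]
    positivity)).tendsto_measureReal (hu.div_const 2).neg
  have h1 := (h.isLyapunovArray_quadSummand hc hu (Q := Q) (by
    filter_upwards [hQ] with k hk
    exact hk.2.2)).tendsto_measureReal (hu.div_const 2)
  have hsum := (h0.const_sub 1).add h1
  rw [neg_neg, one_sub_stdNormalCDF, ← two_mul, ← neg_div] at hsum
  refine ⟨_, hsum, ?_⟩
  filter_upwards [h.eventually_pos, hQ] with k hk hQk
  have hn := hk.1
  refine add_le_add (le_of_eq ?_) (measureReal_mono fun o ho => ?_)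
  · rw [← dataLaw, ← probReal_compl_eq_one_sub (Set.to_countable _).measurableSet]
    congr 1
    ext o
    have e : ∀ i, ((n k * uniformRate (N k) i).toNNReal : ℝ) - n k / N k = 0 := fun i => by
      rw [Real.coe_toNNReal _ (by unfold uniformRate; positivity), uniformRate]
      ring
    have hf := quadTest_eq_false_iff (uStar p (ε k) (n k) (N k) / 2) (uniformRate (N k)) o
      (n := n k)
    simp only [e] at hf
    simp only [Set.mem_compl_iff, Set.mem_ofPred_eq]
    rw [← Bool.not_eq_false, hf]
    simp
  · have ho' := (quadTest_eq_false_iff _ (Q k) o).1 ho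
    have := uStar_le_mean h.p_pos h.p_le_two hk.2.1 hn (h.eps_pos k).le hQk.1
    simp only [Set.mem_ofPred_eq]
    linarith

/-- The upper bound. For a positive limit, near-maximizers of the risk of the quadratic test are fed
to the bound along sequences; for `c = 0` that test need not be asymptotically normal, and the trivial
test suffices. -/
lemma exists_upper_bound (h : IsRegime p M n N ε ξ) {c : ℝ} (hc : 0 ≤ c)
    (hu : Tendsto (fun k => uStar p (ε k) (n k) (N k)) atTop (𝓝 c)) :
    ∃ A : ℕ → ℝ, Tendsto A atTop (𝓝 (2 * stdNormalCDF (-c / 2))) ∧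
      ∀ᶠ k in atTop, minimaxRisk (n k) (altSetCube (N k) p (ε k) (ξ k)) ≤ A k := by
  rcases hc.eq_or_lt with rfl | hc
  · refine ⟨fun _ => 1, ?_, Eventually.of_forall fun k => minimaxRisk_le_one _ _⟩
    rw [neg_zero, zero_div, stdNormalCDF_zero]
    norm_num
  · have hsel : ∀ k, ∃ Q, (altSetCube (N k) p (ε k) (ξ k)).Nonempty →
        Q ∈ altSetCube (N k) p (ε k) (ξ k) ∧
        minimaxRisk (n k) (altSetCube (N k) p (ε k) (ξ k)) ≤
          risk (n k) (quadTest (n k) (N k) (uStar p (ε k) (n k) (N k) / 2)) Q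
            + 1 / ((k : ℝ) + 1) := by
      intro k
      by_cases hne : (altSetCube (N k) p (ε k) (ξ k)).Nonempty
      · have : Nonempty (altSetCube (N k) p (ε k) (ξ k)) := hne.to_subtype
        have hpos : (0 : ℝ) < 1 / ((k : ℝ) + 1) := by positivity
        obtain ⟨Q, hQ⟩ := exists_lt_of_lt_ciSup (sub_lt_self
          (⨆ Q : altSetCube (N k) p (ε k) (ξ k),
            risk (n k) (quadTest (n k) (N k) (uStar p (ε k) (n k) (N k) / 2)) Q.1) hpos)
        refine ⟨Q.1, fun _ => ⟨Q.2, (minimaxRisk_le_iSup _ _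
          (quadTest (n k) (N k) (uStar p (ε k) (n k) (N k) / 2))).trans ?_⟩⟩
        exact (sub_lt_iff_lt_add.1 hQ).le
      · exact ⟨fun _ => 0, fun h => absurd h hne⟩
    choose Q hQ using hsel
    have hne : ∀ᶠ k in atTop, (altSetCube (N k) p (ε k) (ξ k)).Nonempty := by
      filter_upwards [h.eventually_pos] with k hk
      exact ⟨_, signedRate_mem_altSetCube h.p_pos hk.2.1 (h.eps_pos k).le (h.eps_le k)
        ((relPert_le hk.2.1 (h.eps_le k)).trans hk.2.2) fun _ => true⟩
    obtain ⟨A, hA, hle⟩ := h.exists_risk_quadTest_le hc hu (Q := Q)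
      (hne.mono fun k hk => (hQ k hk).1)
    refine ⟨fun k => A k + 1 / ((k : ℝ) + 1), ?_, ?_⟩
    · simpa using hA.add tendsto_one_div_add_atTop_nhds_zero_nat
    · filter_upwards [hne, hle] with k hk hle
      exact (hQ k hk).2.trans (by linarith)

/-! ### Subsequences and the conclusion -/

/-- The lower bound without any assumption on the behaviour of `u*`. -/
lemma exists_remainder (h : IsRegime p M n N ε ξ) :
    ∃ r : ℕ → ℝ, Tendsto r atTop (𝓝 0) ∧ ∀ k,
      2 * stdNormalCDF (-uStar p (ε k) (n k) (N k) / 2) + r k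
        ≤ minimaxRisk (n k) (altSetCube (N k) p (ε k) (ξ k)) := by
  set u : ℕ → ℝ := fun k => uStar p (ε k) (n k) (N k) with hu
  set R : ℕ → ℝ := fun k => minimaxRisk (n k) (altSetCube (N k) p (ε k) (ξ k)) with hR
  have hΦ : Continuous fun x : ℝ => 2 * stdNormalCDF (-x / 2) :=
    (continuous_stdNormalCDF.comp (by fun_prop)).const_mul 2
  refine ⟨fun k => min 0 (R k - 2 * stdNormalCDF (-u k / 2)), ?_, fun k => ?_⟩
  · refine tendsto_of_subseq_tendsto fun φ hφ => ?_
    -- `u*` is eventually nonnegative, so it has a subsequential limit in `[0, ∞]`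
    have hunn : ∀ᶠ k in atTop, 0 ≤ u k := by
      filter_upwards [h.eventually_pos] with k hk
      have := hk.1
      simp only [hu, uStar]
      positivity
    obtain ⟨L, -, ψ, hψ, hL⟩ := isCompact_univ.tendsto_subseq
      (x := fun k => ENNReal.ofReal (u (φ k))) fun _ => Set.mem_univ _
    have hφψ : Tendsto (fun k => φ (ψ k)) atTop atTop := hφ.comp hψ.tendsto_atTop
    refine ⟨ψ, ?_⟩
    rcases eq_or_ne L ⊤ with rfl | hLt
    · have hutop : Tendsto (fun k => u (φ (ψ k))) atTop atTop :=
        ENNReal.tendsto_ofReal_nhds_top.1 hL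
      have hΦ0 : Tendsto (fun k => -(2 * stdNormalCDF (-u (φ (ψ k)) / 2))) atTop (𝓝 0) := by
        have h1 : Tendsto (fun k => -u (φ (ψ k)) / 2) atTop atBot :=
          (tendsto_neg_atTop_atBot.comp hutop).atBot_div_const two_pos
        have := ((tendsto_stdNormalCDF_atBot.comp h1).const_mul 2).neg
        simpa using this
      refine tendsto_of_tendsto_of_tendsto_of_le_of_le hΦ0 tendsto_const_nhds
        (fun k => ?_) (fun k => min_le_left _ _)
      have h1 := minimaxRisk_nonneg (n (φ (ψ k)))
        (altSetCube (N (φ (ψ k))) p (ε (φ (ψ k))) (ξ (φ (ψ k))))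
      have h2 := stdNormalCDF_nonneg (-u (φ (ψ k)) / 2)
      exact le_min (by linarith) (by simp only [hR]; linarith)
    · have hulim : Tendsto (fun k => u (φ (ψ k))) atTop (𝓝 L.toReal) := by
        refine ((ENNReal.tendsto_toReal hLt).comp hL).congr' ?_
        filter_upwards [hφψ.eventually hunn] with k hk
        exact ENNReal.toReal_ofReal hk
      obtain ⟨B, hB, hBle⟩ := (h.comp hφψ).exists_lower_bound ENNReal.toReal_nonneg hulim
      have hd : Tendsto (fun k => min 0 (B k - 2 * stdNormalCDF (-u (φ (ψ k)) / 2))) atTop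
          (𝓝 0) := by
        have := (tendsto_const_nhds (x := (0 : ℝ))).min
          (hB.sub ((hΦ.tendsto L.toReal).comp hulim))
        simpa using this
      refine tendsto_of_tendsto_of_tendsto_of_le_of_le' hd tendsto_const_nhds ?_
        (Eventually.of_forall fun k => min_le_left _ _)
      filter_upwards [hBle] with k hk
      exact min_le_min_left 0 (sub_le_sub_right hk _)
  · have := min_le_right 0 (R k - 2 * stdNormalCDF (-u k / 2))
    linarith

end IsRegime

/-- A vanishing quantity that dominates `2 Φ(-u*/2) + o(1)` forces `u* → ∞`. -/
lemma tendsto_uStar_atTop {u R r : ℕ → ℝ} (hr : Tendsto r atTop (𝓝 0))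
    (hle : ∀ k, 2 * stdNormalCDF (-u k / 2) + r k ≤ R k) (hR : Tendsto R atTop (𝓝 0)) :
    Tendsto u atTop atTop := by
  rw [tendsto_atTop]
  intro A
  have hpos : 0 < 2 * stdNormalCDF (-A / 2) := mul_pos two_pos (stdNormalCDF_pos _)
  have hd : Tendsto (fun k => R k - r k) atTop (𝓝 0) := by simpa using hR.sub hr
  filter_upwards [hd.eventually_lt_const hpos] with k hk
  by_contra hlt
  push Not at hlt
  have := stdNormalCDF_mono (show -A / 2 ≤ -u k / 2 by linarith)
  linarith [hle k]

end PoissonUniformity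

theorem theorem3 (p M : ℝ) (hp0 : 0 < p) (hp2 : p ≤ 2)
    (n : ℕ → ℝ) (N : ℕ → ℕ) (ε ξ : ℕ → ℝ)
    (hn : Tendsto n atTop atTop) (hN : Tendsto N atTop atTop)
    (hM : ∀ k, n k / (N k : ℝ) ≤ M)
    (hε_pos : ∀ k, 0 < ε k)
    (hε : Tendsto ε atTop (𝓝 0)) (hξ : Tendsto ξ atTop (𝓝 0))
    (hεξ : ∀ k, ε k ≤ ξ k * (N k : ℝ) ^ (-1 + 1 / p)) :
    -- sharp asymptotics of the minimax risk over the alternatives in the hypercube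
    (∀ c : ℝ, 0 ≤ c →
      Tendsto (fun k => PoissonUniformity.uStar p (ε k) (n k) (N k)) atTop (𝓝 c) →
      Tendsto (fun k =>
        PoissonUniformity.minimaxRisk (n k)
            (PoissonUniformity.altSetCube (N k) p (ε k) (ξ k)) /
          (2 * PoissonUniformity.stdNormalCDF
            (-PoissonUniformity.uStar p (ε k) (n k) (N k) / 2))) atTop (𝓝 1)) ∧
    -- lower bound for the full set of alternatives
    (∃ r : ℕ → ℝ, Tendsto r atTop (𝓝 0) ∧ ∀ k,
      2 * PoissonUniformity.stdNormalCDF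
          (-PoissonUniformity.uStar p (ε k) (n k) (N k) / 2) + r k ≤
        PoissonUniformity.minimaxRisk (n k) (PoissonUniformity.altSet (N k) p (ε k))) ∧
    -- necessary condition for a vanishing minimax risk, over either set of alternatives
    (Tendsto (fun k => PoissonUniformity.minimaxRisk (n k)
        (PoissonUniformity.altSetCube (N k) p (ε k) (ξ k))) atTop (𝓝 0) →
      Tendsto (fun k => ε k ^ 2 * n k * (N k : ℝ) ^ (2 - 2 / p) / Real.sqrt (N k : ℝ))
        atTop atTop) ∧
    (Tendsto (fun k => PoissonUniformity.minimaxRisk (n k)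
        (PoissonUniformity.altSet (N k) p (ε k))) atTop (𝓝 0) →
      Tendsto (fun k => ε k ^ 2 * n k * (N k : ℝ) ^ (2 - 2 / p) / Real.sqrt (N k : ℝ))
        atTop atTop) := by
  have h : PoissonUniformity.IsRegime p M n N ε ξ := ⟨hp0, hp2, hn, hN, hM, hε_pos, hξ, hεξ⟩
  obtain ⟨r, hr, hle⟩ := h.exists_remainder
  have hmono : ∀ k, PoissonUniformity.minimaxRisk (n k)
      (PoissonUniformity.altSetCube (N k) p (ε k) (ξ k)) ≤
      PoissonUniformity.minimaxRisk (n k) (PoissonUniformity.altSet (N k) p (ε k)) := fun k =>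
    PoissonUniformity.minimaxRisk_mono _ Set.inter_subset_left
  have hscale : Tendsto (fun k => PoissonUniformity.uStar p (ε k) (n k) (N k)) atTop atTop →
      Tendsto (fun k => ε k ^ 2 * n k * (N k : ℝ) ^ (2 - 2 / p) / Real.sqrt (N k : ℝ))
        atTop atTop := by
    intro hu
    refine (hu.const_mul_atTop (Real.sqrt_pos.2 (two_pos : (0 : ℝ) < 2))).congr fun k => ?_
    have : √(2 : ℝ) ≠ 0 := (Real.sqrt_pos.2 two_pos).ne'
    rw [PoissonUniformity.uStar, Real.sqrt_mul two_pos.le]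
    rcases eq_or_ne (√(N k : ℝ)) 0 with h0 | h0
    · simp [h0]
    · field_simp
  refine ⟨fun c hc hu => ?_, ⟨r, hr, fun k => (hle k).trans (hmono k)⟩,
    fun hR => hscale (PoissonUniformity.tendsto_uStar_atTop hr hle hR),
    fun hR => hscale (PoissonUniformity.tendsto_uStar_atTop hr
      (fun k => (hle k).trans (hmono k)) hR)⟩
  have hpos : 0 < 2 * PoissonUniformity.stdNormalCDF (-c / 2) :=
    mul_pos two_pos (PoissonUniformity.stdNormalCDF_pos _)
  have hΦ : Tendsto (fun k => 2 * PoissonUniformity.stdNormalCDF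
      (-PoissonUniformity.uStar p (ε k) (n k) (N k) / 2)) atTop
      (𝓝 (2 * PoissonUniformity.stdNormalCDF (-c / 2))) :=
    ((PoissonUniformity.continuous_stdNormalCDF.tendsto _).comp
      (hu.neg.div_const 2)).const_mul 2
  obtain ⟨B, hB, hBle⟩ := h.exists_lower_bound hc hu
  obtain ⟨A, hA, hAle⟩ := h.exists_upper_bound hc hu
  have hlim := (tendsto_of_tendsto_of_tendsto_of_le_of_le' hB hA hBle hAle).div hΦ hpos.ne'
  rwa [div_self hpos.ne'] at hlim
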